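/- Let $M=(m_{st})_{s,t\in S}$ be a Coxeter matrix on a set $S$ and let $W=\langle S\mid (st)^{m_{st}}=1\rangle$ be the Coxeter group of type $M$. A word over $S$ is *reduced* if no shorter word represents the same element of $W$. For $s\ne t$ let $p_m(s,t)=stst\cdots$ be the alternating word of length $m$ that begins with $s$; if $m_{st}<\infty$, put $p(s,t)=p_{m_{st}}(s,t)$. *Weyl data* $\mathcal W$ of type $M$ consist of a set of chambers, for each $s\in S$ a groupoid $\mathcal W_s$ whose set of vertices is the set of chambers, and, for all $s\neq t$ with $m_{st}<\infty$, a set of closed galleries of type $p_{2m_{st}}(s,t)$, called *defining suites*. The *edges* of type $s$ are the non-identity arrows of $\mathcal W_s$; a *gallery* is a finite path of edges (of arbitrary types), its *type* is the word formed by the types of its edges, and its *$W$-length* is the element of $W$ that its type represents. A *panel* is a connected component of some $\mathcal W_s$. A *contraction* of a gallery deletes a subgallery $i\,i^{-1}$, or replaces a subgallery $j\,j'$ of two edges of the same type with $j'\neq j^{-1}$ by their composite edge $j;j'$, or deletes a defining suite. Two galleries are *homotopic* if one is obtained from the other by finitely many contractions and inverses of contractions. They are *strictly homotopic* if one is obtained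 from the other by finitely many replacements of a subgallery of type $p(s,t)$ by a homotopic gallery of type $p(t,s)$ (where $s\ne t$, $m_{st}<\infty$). A *geodesic* is a gallery of reduced type; it is an *alternating geodesic* if its type is $p_m(s,t)$ for some $m\ge 0$ and some $s\neq t$ with $m_{st}<\infty$. $\mathcal W$ is a *pre-Weyl graph* if no panel is the trivial groupoid with one vertex and one arrow, and, for all $s\ne t$ with $m_{st}<\infty$, each gallery of type $p(s,t)$ is homotopic to a gallery of type $p(t,s)$. It is a *$2$-Weyl graph* if, moreover, homotopic alternating geodesics have the same $W$-length. The *Weyl properties* are: - (C) homotopic geodesics are strictly homotopic; - (W) homotopic geodesics have the same $W$-length; - (H) homotopic geodesics of the same type are equal; - (SH) strictly homotopic geodesics of the same type are equal. A *Weyl graph* is a pre-Weyl graph with property (W). **Theorem.** Let $\mathcal W$ be a $2$-Weyl graph. Then (C) $\Rightarrow$ (W) $\Rightarrow$ (H) $\Rightarrow$ (SH) $\Rightarrow$ (C). In particular, if $\mathcal W$ has any one of the four Weyl properties, then $\mathcal W$ is a Weyl graph. Conversely, every Weyl graph satisfies all four Weyl properties. -/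

import Mathlib

open CategoryTheory

universe u v w

/-- The word `p_m(s,t) = s t s t ⋯` of length `m`, which begins with the letter `s`. -/
def alternatingFrom {S : Type u} : S → S → ℕ → List S
  | _, _, 0 => []
  | s, t, m + 1 => s :: alternatingFrom t s m

/-- A generalized chamber system labelled over `S`: a set of chambers, and for each `s : S` a
groupoid (the panel groupoid of type `s`) whose vertices are the chambers. -/
structure GeneralizedChamberSystem (S : Type u) where
  Chamber : Type v
  panelGroupoid : S → Groupoid.{w} Chamber

namespace GeneralizedChamberSystem

variable {S : Type u} (𝒲 : GeneralizedChamberSystem.{u, v, w} S)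

/-- The arrows `C ⟶ D` of the panel groupoid of type `s`. -/
abbrev Arrow (s : S) (C D : 𝒲.Chamber) : Type w := (𝒲.panelGroupoid s).Hom C D

/-- The identity of `C` in the panel groupoid of type `s`. -/
abbrev idArrow (s : S) (C : 𝒲.Chamber) : 𝒲.Arrow s C C := (𝒲.panelGroupoid s).id C

variable {𝒲}

/-- Composition in the panel groupoid of type `s` (first `f`, then `g`). -/
abbrev compArrow {s : S} {C D E : 𝒲.Chamber} (f : 𝒲.Arrow s C D) (g : 𝒲.Arrow s D E) :
    𝒲.Arrow s C E := (𝒲.panelGroupoid s).comp f g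

/-- Inversion in the panel groupoid of type `s`. -/
abbrev invArrow {s : S} {C D : 𝒲.Chamber} (f : 𝒲.Arrow s C D) : 𝒲.Arrow s D C :=
  (𝒲.panelGroupoid s).inv f

/-- An arrow of a panel groupoid is trivial if it is an identity. -/
def IsTrivialArrow {s : S} {C D : 𝒲.Chamber} (f : 𝒲.Arrow s C D) : Prop :=
  ∃ h : C = D, f = h ▸ 𝒲.idArrow s C

theorem not_isTrivialArrow_inv {s : S} {C D : 𝒲.Chamber} {f : 𝒲.Arrow s C D}
    (hf : ¬ IsTrivialArrow f) : ¬ IsTrivialArrow (invArrow f) := by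
  let _ := 𝒲.panelGroupoid s
  rintro ⟨h, e⟩
  subst h
  refine hf ⟨rfl, ?_⟩
  change f = 𝟙 D
  have e' : Groupoid.inv f = 𝟙 D := e
  calc f = f ≫ Groupoid.inv f := by rw [e', Category.comp_id]
    _ = 𝟙 D := Groupoid.comp_inv f

/-- A composite of `f` and `g` is trivial exactly when `g` is the inverse of `f`. -/
theorem isTrivialArrow_comp_iff {s : S} {C D : 𝒲.Chamber} (f : 𝒲.Arrow s C D)
    (g : 𝒲.Arrow s D C) : IsTrivialArrow (compArrow f g) ↔ g = invArrow f := by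
  let _ := 𝒲.panelGroupoid s
  constructor
  · rintro ⟨_, e⟩
    have e' : f ≫ g = 𝟙 C := e
    change g = Groupoid.inv f
    calc g = Groupoid.inv f ≫ (f ≫ g) := by simp
      _ = Groupoid.inv f := by rw [e', Category.comp_id]
  · rintro rfl
    exact ⟨rfl, Groupoid.comp_inv f⟩

variable (𝒲)

/-- The edges from `C` to `D` of the underlying labelled graph: the non-trivial arrows of the
panel groupoids, each carrying its type. -/
structure Edge (C D : 𝒲.Chamber) where
  type : S
  arrow : 𝒲.Arrow type C D
  nontrivial : ¬ IsTrivialArrow arrow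

instance : Quiver 𝒲.Chamber := ⟨𝒲.Edge⟩

variable {𝒲}

/-- The inverse `i⁻¹` of an edge, taken in its panel groupoid. -/
def Edge.inverse {C D : 𝒲.Chamber} (i : 𝒲.Edge C D) : 𝒲.Edge D C :=
  ⟨i.type, invArrow i.arrow, not_isTrivialArrow_inv i.nontrivial⟩

variable (𝒲) in
/-- A gallery from `C` to `D`: a finite path of edges in the underlying graph. -/
abbrev Gallery (C D : 𝒲.Chamber) := Quiver.Path C D

/-- The gallery which consists of one edge. -/
abbrev Edge.gallery {C D : 𝒲.Chamber} (i : 𝒲.Edge C D) : 𝒲.Gallery C D :=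
  Quiver.Hom.toPath (V := 𝒲.Chamber) i

/-- The type of a gallery: the word formed by the types of its edges. -/
def Gallery.word {C : 𝒲.Chamber} : {D : 𝒲.Chamber} → 𝒲.Gallery C D → List S
  | _, .nil => []
  | _, .cons β i => Gallery.word β ++ [Edge.type i]

/-- The `s`-panel of `C` (the connected component of `C` in the panel groupoid of type `s`) has
only one chamber and only one arrow. -/
def HasTrivialPanel (s : S) (C : 𝒲.Chamber) : Prop :=
  (∀ D : 𝒲.Chamber, Nonempty (𝒲.Arrow s C D) → D = C) ∧
    ∀ f : 𝒲.Arrow s C C, f = 𝒲.idArrow s C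

end GeneralizedChamberSystem

open GeneralizedChamberSystem

/-- Weyl data of type `M`: a generalized chamber system with, for all `s ≠ t` with `m_{st} < ∞`,
a set of `(s,t)`-cycles (closed galleries of type `p_{2 m_{st}}(s,t)`), the defining suites.
In a `CoxeterMatrix` the entry `0` stands for `∞`. -/
structure WeylData {S : Type u} (M : CoxeterMatrix S) extends
    GeneralizedChamberSystem.{u, v, w} S where
  definingSuites : S → S → ∀ C : Chamber, Set (toGeneralizedChamberSystem.Gallery C C)
  ne_of_mem : ∀ {s t : S} {C : Chamber} {θ : toGeneralizedChamberSystem.Gallery C C},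
    θ ∈ definingSuites s t C → s ≠ t
  finite_of_mem : ∀ {s t : S} {C : Chamber} {θ : toGeneralizedChamberSystem.Gallery C C},
    θ ∈ definingSuites s t C → M s t ≠ 0
  word_of_mem : ∀ {s t : S} {C : Chamber} {θ : toGeneralizedChamberSystem.Gallery C C},
    θ ∈ definingSuites s t C → Gallery.word θ = alternatingFrom s t (2 * M s t)

namespace WeylData

variable {S : Type u} {M : CoxeterMatrix S} (𝒲 : WeylData.{u, v, w} M)

/-- Galleries in the underlying graph of Weyl data. -/
abbrev Gallery (C D : 𝒲.Chamber) := 𝒲.toGeneralizedChamberSystem.Gallery C D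

variable {𝒲}

/-- The type of a gallery, a word over `S`. -/
abbrev word {C D : 𝒲.Chamber} (β : 𝒲.Gallery C D) : List S :=
  GeneralizedChamberSystem.Gallery.word β

/-- The `W`-length of a gallery: the element of the Coxeter group which its type represents. -/
noncomputable def wLength {C D : 𝒲.Chamber} (β : 𝒲.Gallery C D) : M.Group :=
  M.toCoxeterSystem.wordProd (word β)

/-- A geodesic: a gallery of reduced type. -/
def IsGeodesic {C D : 𝒲.Chamber} (β : 𝒲.Gallery C D) : Prop :=
  M.toCoxeterSystem.IsReduced (word β)

/-- An alternating geodesic: a geodesic of type `p_m(s,t)`, with `s ≠ t` and `m_{st} < ∞`. -/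
def IsAlternatingGeodesic {C D : 𝒲.Chamber} (β : 𝒲.Gallery C D) : Prop :=
  IsGeodesic β ∧ ∃ s t : S, s ≠ t ∧ M s t ≠ 0 ∧ ∃ m : ℕ, word β = alternatingFrom s t m

/-- A maximal `(s,t)`-geodesic: a gallery of type `p(s,t) = p_{m_{st}}(s,t)`, with `s ≠ t` and
`m_{st} < ∞`. -/
def IsMaximalGeodesic (s t : S) {C D : 𝒲.Chamber} (β : 𝒲.Gallery C D) : Prop :=
  s ≠ t ∧ M s t ≠ 0 ∧ word β = alternatingFrom s t (M s t)

/-- The contractions of galleries: delete a backtrack `i i⁻¹`; replace a detour `j j'` by the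
single edge `j ; j'`; delete a defining suite. -/
inductive Contraction : ∀ {C D : 𝒲.Chamber}, 𝒲.Gallery C D → 𝒲.Gallery C D → Prop
  | backtrack {C D E F : 𝒲.Chamber} (β : 𝒲.Gallery C D)
      (i : 𝒲.toGeneralizedChamberSystem.Edge D E) (β' : 𝒲.Gallery D F) :
      Contraction (β.comp ((i.gallery.comp i.inverse.gallery).comp β')) (β.comp β')
  | shortcut {C D E F G : 𝒲.Chamber} (β : 𝒲.Gallery C D) (s : S)
      (j : 𝒲.Arrow s D E) (j' : 𝒲.Arrow s E F) (β' : 𝒲.Gallery F G)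
      (hj : ¬ IsTrivialArrow j) (hj' : ¬ IsTrivialArrow j')
      (hjj' : ¬ IsTrivialArrow (compArrow j j')) :
      Contraction
        (β.comp (((Edge.mk s j hj).gallery.comp (Edge.mk s j' hj').gallery).comp β'))
        (β.comp ((Edge.mk s (compArrow j j') hjj').gallery.comp β'))
  | suite {C D E : 𝒲.Chamber} (β : 𝒲.Gallery C D) (s t : S) (θ : 𝒲.Gallery D D)
      (β' : 𝒲.Gallery D E) (hθ : θ ∈ 𝒲.definingSuites s t D) :
      Contraction (β.comp (θ.comp β')) (β.comp β')

/-- Homotopy of galleries: a finite composition of contractions and expansions. -/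
def Homotopic {C D : 𝒲.Chamber} (β β' : 𝒲.Gallery C D) : Prop :=
  Relation.EqvGen Contraction β β'

/-- An elementary strict homotopy: replace a maximal `(s,t)`-geodesic in a gallery by a
homotopic maximal `(t,s)`-geodesic. -/
inductive ElementaryStrictHomotopy :
    ∀ {C D : 𝒲.Chamber}, 𝒲.Gallery C D → 𝒲.Gallery C D → Prop
  | mk {C D E F : 𝒲.Chamber} (β : 𝒲.Gallery C D) (s t : S) (ρ ρ' : 𝒲.Gallery D E)
      (β' : 𝒲.Gallery E F) (hρ : IsMaximalGeodesic s t ρ) (hρ' : IsMaximalGeodesic t s ρ')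
      (h : Homotopic ρ ρ') :
      ElementaryStrictHomotopy (β.comp (ρ.comp β')) (β.comp (ρ'.comp β'))

/-- Strict homotopy of galleries: a finite composition of elementary strict homotopies. -/
def StrictlyHomotopic {C D : 𝒲.Chamber} (β β' : 𝒲.Gallery C D) : Prop :=
  Relation.ReflTransGen ElementaryStrictHomotopy β β'

variable (𝒲)

/-- A pre-Weyl graph: no panel is the trivial groupoid with one edge, and each maximal
`(s,t)`-geodesic is homotopic to a maximal `(t,s)`-geodesic. -/
structure IsPreWeylGraph : Prop where
  pw0 : ∀ (s : S) (C : 𝒲.Chamber),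
    ¬ HasTrivialPanel (𝒲 := 𝒲.toGeneralizedChamberSystem) s C
  pw1 : ∀ (s t : S) {C D : 𝒲.Chamber} (ρ : 𝒲.Gallery C D), IsMaximalGeodesic s t ρ →
    ∃ ρ' : 𝒲.Gallery C D, IsMaximalGeodesic t s ρ' ∧ Homotopic ρ ρ'

/-- A `2`-Weyl graph: a pre-Weyl graph in which homotopic alternating geodesics have the same
`W`-length. -/
structure IsTwoWeylGraph : Prop extends 𝒲.IsPreWeylGraph where
  twoW : ∀ {C D : 𝒲.Chamber} (γ γ' : 𝒲.Gallery C D), IsAlternatingGeodesic γ →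
    IsAlternatingGeodesic γ' → Homotopic γ γ' → wLength γ = wLength γ'

/-- Property (C): homotopic geodesics are strictly homotopic. -/
def PropertyC : Prop :=
  ∀ {C D : 𝒲.Chamber} (γ γ' : 𝒲.Gallery C D), IsGeodesic γ → IsGeodesic γ' →
    Homotopic γ γ' → StrictlyHomotopic γ γ'

/-- Property (W): homotopic geodesics have the same `W`-length. -/
def PropertyW : Prop :=
  ∀ {C D : 𝒲.Chamber} (γ γ' : 𝒲.Gallery C D), IsGeodesic γ → IsGeodesic γ' →
    Homotopic γ γ' → wLength γ = wLength γ'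

/-- Property (H): homotopic geodesics of the same type are equal. -/
def PropertyH : Prop :=
  ∀ {C D : 𝒲.Chamber} (γ γ' : 𝒲.Gallery C D), IsGeodesic γ → IsGeodesic γ' →
    word γ = word γ' → Homotopic γ γ' → γ = γ'

/-- Property (SH): strictly homotopic geodesics of the same type are equal. -/
def PropertySH : Prop :=
  ∀ {C D : 𝒲.Chamber} (γ γ' : 𝒲.Gallery C D), IsGeodesic γ → IsGeodesic γ' →
    word γ = word γ' → StrictlyHomotopic γ γ' → γ = γ'

/-- A Weyl graph: a pre-Weyl graph with property (W). -/
structure IsWeylGraph : Prop extends 𝒲.IsPreWeylGraph where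
  propertyW : 𝒲.PropertyW

end WeylData

/-! ### Coxeter groups: the exchange condition -/

namespace CoxeterSystem

variable {B W : Type*} [Group W] {M : CoxeterMatrix B} (cs : CoxeterSystem M W)

/-! (C) ⇒ (W) holds because a strict homotopy changes the type by braid relations only. (H) ⇒ (SH)
holds because strict homotopies are homotopies. For (W) ⇒ (H), compare the last edges `j`, `j'` of
two homotopic geodesics of the same type: if `j ; j'⁻¹` were not an identity, a geodesic would be
homotopic to one shorter by a letter, against (W); so the last edges agree up to the remaining
geodesics, which are equal by induction (`eq_of_homotopic_of_wLength_eq`).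

The substance is (SH) ⇒ (C). A homotopy may pass through galleries that are not geodesics, so all
galleries are made to act on the strict homotopy classes of geodesics with a fixed first chamber. By
Matsumoto's theorem and the pre-Weyl condition, each class is that of `γ` followed by a possibly
trivial arrow `b` of type `s`, where `γ` extends to a geodesic by any edge of type `s`; an arrow `a`
of type `s` replaces `b` by `b ; a`. Property (SH) makes this well defined (`ArrowRel.unique`), and
it respects composition, so backtracks and shortcuts do not change the action.

For a defining suite of type `{s,t}`, write the class as `γ₀ α` with `γ₀` of minimal `W`-length in
its `{s,t}`-coset and `α` with letters in `{s,t}`. The suite changes `α` only within its homotopy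
class, and the 2-Weyl condition makes the result strictly homotopic to `α`. Hence homotopic
galleries act alike; since a geodesic takes the class of the empty gallery to its own class,
homotopic geodesics are strictly homotopic.

The Coxeter group theory needed is the exchange condition, the exact order of `st`, minimal coset
representatives and Matsumoto's theorem. -/

open List in
-- The second half of the inversion sequence repeats the first: its entries are odd alternating
-- products, and lengthening one by `2 * M i j` letters does not change it, as `(s_i s_j)^(M i j) =
-- 1`.
theorem even_count_leftInvSeq_alternatingWord [DecidableEq W] (i j : B) (t : W) :
    Even (count t (cs.leftInvSeq (alternatingWord i j (2 * M i j)))) := by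
  set L := cs.leftInvSeq (alternatingWord i j (2 * M i j)) with hL
  have hlen : L.length = 2 * M i j := by simp [hL]
  have h : L.drop (M i j) = L.take (M i j) := by
    apply List.ext_getElem
    · simp [hlen]; omega
    · intro k h₁ h₂
      have hk : k < M i j := by simp only [length_take, hlen] at h₂; omega
      rw [getElem_drop, getElem_take]
      simp only [hL]
      rw [cs.getElem_leftInvSeq_alternatingWord i j _ _ (by omega),
        cs.getElem_leftInvSeq_alternatingWord i j _ _ (by omega),
        cs.prod_alternatingWord_eq_mul_pow, cs.prod_alternatingWord_eq_mul_pow]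
      have e₁ : (2 * (M i j + k) + 1) / 2 = M i j + k := by omega
      have e₂ : (2 * k + 1) / 2 = k := by omega
      have o₁ : ¬ Even (2 * (M i j + k) + 1) := by simp
      have o₂ : ¬ Even (2 * k + 1) := by simp
      rw [e₁, e₂, if_neg o₁, if_neg o₂, pow_add, M.symmetric, cs.simple_mul_simple_pow, one_mul]
  rw [← take_append_drop (M i j) L, count_append, h]
  exact ⟨_, rfl⟩

open Classical in
/-- The simple reflection `s i` acting on elements of `W` by conjugation, together with a sign
that changes exactly on `s i`. -/
noncomputable def signedConj (i : B) : Equiv.Perm (W × ZMod 2) :=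
  Function.Involutive.toPerm
    (fun p => (cs.simple i * p.1 * cs.simple i, p.2 + if p.1 = cs.simple i then 1 else 0)) <| by
    rintro ⟨t, ε⟩
    have h : cs.simple i * t * cs.simple i = cs.simple i ↔ t = cs.simple i := by
      constructor
      · intro h
        have := congrArg (fun x => cs.simple i * x * cs.simple i) h
        simpa [mul_assoc] using this
      · rintro rfl; simp
    ext
    · simp [mul_assoc]
    · simp only [h]
      split_ifs
      · rw [add_assoc, show (1 : ZMod 2) + 1 = 0 from rfl, add_zero]
      · simp

open Classical in
-- The sign records the parity of the number of occurrences of `t` in the right inversion sequence.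
-- Once the signed conjugations are known to define an action of `W`, this parity depends only on
-- the element that the word represents.
theorem prod_map_signedConj (ω : List B) (t : W) (ε : ZMod 2) :
    (ω.map cs.signedConj).prod (t, ε) =
      (cs.wordProd ω * t * (cs.wordProd ω)⁻¹, ε + (List.count t (cs.rightInvSeq ω) : ℕ)) := by
  induction ω with
  | nil => simp
  | cons i ω ih =>
    rw [List.map_cons, List.prod_cons, Equiv.Perm.mul_apply, ih]
    have h : cs.wordProd ω * t * (cs.wordProd ω)⁻¹ = cs.simple i ↔
        (cs.wordProd ω)⁻¹ * cs.simple i * cs.wordProd ω = t := by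
      constructor
      · intro h; rw [← h]; group
      · rintro rfl; group
    change ((_ : W), (_ : ZMod 2)) = _
    simp only [h, rightInvSeq, List.count_cons, beq_iff_eq, wordProd_cons, mul_inv_rev, inv_simple]
    ext1
    · simp only [mul_assoc]
    · split_ifs <;> simp [add_assoc]

theorem isLiftable_signedConj : M.IsLiftable cs.signedConj := by
  classical
  intro i j
  have h : ∀ n, (cs.signedConj i * cs.signedConj j) ^ n =
      ((alternatingWord i j (2 * n)).map cs.signedConj).prod := by
    intro n
    induction n with
    | zero => simp [alternatingWord]
    | succ n ih =>
      rw [pow_succ, ih, show 2 * (n + 1) = 2 * n + 1 + 1 by ring, alternatingWord_succ,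
        alternatingWord_succ]
      simp
  rw [h]
  ext1 ⟨t, ε⟩
  have hrev : (alternatingWord i j (2 * M i j)).reverse = alternatingWord j i (2 * M i j) := by
    generalize M i j = n
    induction n with
    | zero => simp [alternatingWord]
    | succ n ih =>
      rw [show 2 * (n + 1) = 2 * n + 1 + 1 by ring, alternatingWord_succ, alternatingWord_succ,
        alternatingWord_succ' j i (2 * n + 1), alternatingWord_succ' j i (2 * n)]
      simp [ih]
  have hev : Even (List.count t (cs.rightInvSeq (alternatingWord i j (2 * M i j)))) := by
    have := cs.even_count_leftInvSeq_alternatingWord j i t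
    rw [M.symmetric j i, ← hrev, cs.leftInvSeq_reverse, List.count_reverse] at this
    exact this
  rw [prod_map_signedConj, prod_alternatingWord_eq_mul_pow, (ZMod.natCast_eq_zero_iff_even).2 hev]
  simp

/-- The exchange condition. -/
theorem exists_mul_simple_eq_eraseIdx {ω : List B} {i : B}
    (h : cs.IsRightDescent (cs.wordProd ω) i) :
    ∃ k < ω.length, cs.wordProd ω * cs.simple i = cs.wordProd (ω.eraseIdx k) := by
  classical
  obtain ⟨ω', hω', hp⟩ := cs.exists_isReduced (cs.wordProd ω * cs.simple i)
  have hp' : cs.wordProd (ω'.concat i) = cs.wordProd ω := by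
    rw [wordProd_concat, ← hp, mul_assoc, simple_mul_simple_self, mul_one]
  have hr : cs.IsReduced (ω'.concat i) := by
    rw [IsReduced, hp', ← (cs.isRightDescent_iff).1 h, hp, hω'.eq]
    simp
  -- The reduced word `ω' i` has `s_i` exactly once in its inversion sequence. By parity `s_i` also
  -- occurs in that of `ω`, and its position there is the letter to delete.
  have hcount : List.count (cs.simple i) (cs.rightInvSeq (ω'.concat i)) = 1 :=
    List.count_eq_one_of_mem hr.nodup_rightInvSeq (by rw [rightInvSeq_concat]; simp)
  have hlift : ∀ ω : List B, cs.lift ⟨_, cs.isLiftable_signedConj⟩ (cs.wordProd ω) =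
      (ω.map cs.signedConj).prod := by
    intro ω
    induction ω with
    | nil => simp
    | cons j ω ih => simp [wordProd_cons, ih]
  have key := congrArg (fun f => (f (cs.simple i, (0 : ZMod 2))).2)
    ((hlift (ω'.concat i)).symm.trans ((congrArg _ hp').trans (hlift ω)))
  simp only [prod_map_signedConj, hcount] at key
  have hmem : cs.simple i ∈ cs.rightInvSeq ω := by
    by_contra hn
    rw [List.count_eq_zero_of_not_mem hn] at key
    simp at key
  obtain ⟨k, hk, he⟩ := List.mem_iff_getElem.1 hmem
  refine ⟨k, by simpa using hk, ?_⟩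
  rw [← wordProd_mul_getD_rightInvSeq, List.getD_eq_getElem _ _ hk, he]

/-! ### The order of a product of two simple reflections -/

/-- The entries of the (doubled) Gram matrix of the geometric representation. -/
noncomputable def _root_.CoxeterMatrix.gram (M : CoxeterMatrix B) (i j : B) : ℝ :=
  if M i j = 0 then -2 else -2 * Real.cos (Real.pi / M i j)

theorem _root_.CoxeterMatrix.gram_symm (M : CoxeterMatrix B) (i j : B) :
    M.gram i j = M.gram j i := by
  simp [CoxeterMatrix.gram, M.symmetric i j]

/-- The linear form `2 B(e_i, ·)` of the geometric representation. -/
noncomputable def _root_.CoxeterMatrix.gramForm (M : CoxeterMatrix B) (i : B) :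
    Module.Dual ℝ (B →₀ ℝ) :=
  Finsupp.linearCombination ℝ (M.gram i)

theorem _root_.CoxeterMatrix.gramForm_single (M : CoxeterMatrix B) (i j : B) :
    M.gramForm i (Finsupp.single j 1) = M.gram i j := by
  simp [CoxeterMatrix.gramForm]

theorem _root_.CoxeterMatrix.gramForm_self (M : CoxeterMatrix B) (i : B) :
    M.gramForm i (Finsupp.single i 1) = 2 := by
  simp [CoxeterMatrix.gramForm_single, CoxeterMatrix.gram]

/-- The simple reflections of the geometric representation. -/
noncomputable def _root_.CoxeterMatrix.geomReflection (M : CoxeterMatrix B) (i : B) :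
    (B →₀ ℝ) ≃ₗ[ℝ] (B →₀ ℝ) :=
  Module.reflection (M.gramForm_self i)

open Polynomial.Chebyshev in
-- For finite `m = M i j`, the product of the two reflections acts as a rotation by `2π/m`. Its
-- powers are given by Chebyshev polynomials at `2 cos (2π/m)`, and the relevant values vanish at
-- the `m`-th power.
theorem _root_.CoxeterMatrix.isLiftable_geomReflection (M : CoxeterMatrix B) :
    M.IsLiftable M.geomReflection := by
  intro i j
  by_cases hij : i = j
  · subst hij
    rw [M.diagonal, pow_one]
    ext1 z
    exact Module.involutive_reflection (M.gramForm_self i) z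
  rcases Nat.eq_zero_or_pos (M i j) with h0 | hpos
  · rw [h0, pow_zero]
  have h1 : M i j ≠ 1 := M.off_diagonal i j hij
  ext1 z
  have ht : (2 : ℝ) * Real.cos (2 * (Real.pi / M i j)) =
      M.gramForm i (Finsupp.single j 1) * M.gramForm j (Finsupp.single i 1) - 2 := by
    rw [M.gramForm_single, M.gramForm_single, M.gram_symm j i, CoxeterMatrix.gram,
      if_neg hpos.ne', Real.cos_two_mul]
    ring
  change (_ : (B →₀ ℝ) ≃ₗ[ℝ] (B →₀ ℝ)) z = z
  rw [CoxeterMatrix.geomReflection, CoxeterMatrix.geomReflection,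
    Module.reflection_mul_reflection_pow_apply (M.gramForm_self i) (M.gramForm_self j) _ z _ ht]
  -- Here the angle is `π` and its sine vanishes, so the formula `S_n(2 cos θ) sin θ = sin ((n+1)θ)`
  -- gives no information.
  by_cases h2 : M i j = 2
  · have hg : M.gram i j = 0 := by simp [CoxeterMatrix.gram, h2]
    rw [M.gramForm_single, M.gramForm_single, M.gram_symm j i, hg, h2]
    have : (2 : ℝ) * Real.cos (2 * (Real.pi / (2 : ℕ))) = -2 := by
      rw [Nat.cast_ofNat, mul_div_cancel₀ _ (two_ne_zero), Real.cos_pi]; norm_num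
    rw [this]
    norm_num
    module
  have h3 : 3 ≤ M i j := by omega
  set m := M i j with hm
  set θ : ℝ := 2 * (Real.pi / m) with hθ
  have hmR : (3 : ℝ) ≤ m := by exact_mod_cast h3
  have hm0 : (m : ℝ) ≠ 0 := by positivity
  have hmθ : (m : ℝ) * θ = 2 * Real.pi := by rw [hθ]; field_simp
  have hsin : Real.sin θ ≠ 0 := by
    refine (Real.sin_pos_of_pos_of_lt_pi (by rw [hθ]; positivity) ?_).ne'
    have := Real.pi_pos
    nlinarith
  have hS : ∀ n : ℤ, (S ℝ n).eval (2 * Real.cos θ) * Real.sin θ = Real.sin ((n + 1) * θ) :=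
    fun n => Polynomial.Chebyshev.S_two_mul_real_cos θ n
  obtain ⟨k, hk | hk⟩ := Nat.even_or_odd' m
  · have e1 : ((m : ℤ) - 2) / 2 = k - 1 := by omega
    have e2 : ((m : ℤ) - 1) / 2 = k - 1 := by omega
    have hz : (S ℝ (k - 1 : ℤ)).eval (2 * Real.cos θ) = 0 := by
      apply (mul_eq_zero_iff_right hsin).1
      rw [hS]
      push_cast
      rw [sub_add_cancel, show (k : ℝ) * θ = Real.pi by
        have : (m : ℝ) = 2 * k := by exact_mod_cast hk
        rw [this] at hmθ; linarith]
      exact Real.sin_pi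
    rw [e1, e2, hz]
    simp
  · have e1 : ((m : ℤ) - 2) / 2 = k - 1 := by omega
    have e2 : ((m : ℤ) - 1) / 2 = k := by omega
    have e3 : ((m : ℤ) - 3) / 2 = k - 1 := by omega
    have e4 : (m : ℤ) / 2 = k := by omega
    have hz : (S ℝ (k : ℤ)).eval (2 * Real.cos θ) + (S ℝ (k - 1 : ℤ)).eval (2 * Real.cos θ) = 0 := by
      apply (mul_eq_zero_iff_right hsin).1
      rw [add_mul, hS, hS]
      push_cast
      have : ((k : ℝ) + 1) * θ = 2 * Real.pi - k * θ := by
        have : (m : ℝ) = 2 * k + 1 := by exact_mod_cast hk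
        rw [this] at hmθ; linarith
      rw [this, sub_add_cancel, Real.sin_two_pi_sub]
      ring
    rw [e1, e2, e3, e4, hz]
    simp

open Polynomial.Chebyshev in
-- The geometric representation bounds the order of `s_i s_j` from below: apply the `n`-th power to
-- the basis vector `e_i` and read off the coordinates at `e_i` and `e_j`. For `M i j = 0` the
-- product is unipotent and not the identity, which forces `n = 0`.
theorem dvd_of_simple_mul_simple_pow_eq_one {i j : B} (hij : i ≠ j) {n : ℕ}
    (h : (cs.simple i * cs.simple j) ^ n = 1) : M i j ∣ n := by
  have h' := congrArg (cs.lift ⟨_, M.isLiftable_geomReflection⟩) h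
  rw [map_pow, map_mul, lift_apply_simple, lift_apply_simple, map_one] at h'
  have hx := LinearEquiv.congr_fun h' (Finsupp.single i (1 : ℝ))
  rw [CoxeterMatrix.geomReflection, CoxeterMatrix.geomReflection,
    Module.reflection_mul_reflection_pow_apply_self (M.gramForm_self i) (M.gramForm_self j) n,
    M.gramForm_single, M.gramForm_single, M.gram_symm j i] at hx
  have hi := DFunLike.congr_fun hx i
  have hj := DFunLike.congr_fun hx j
  simp only [Finsupp.coe_add, Finsupp.coe_smul, Pi.add_apply, Pi.smul_apply, smul_eq_mul,
    LinearEquiv.coe_one, id, Finsupp.single_eq_same, Finsupp.single_eq_of_ne hij,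
    Finsupp.single_eq_of_ne hij.symm, mul_one, mul_zero, add_zero, zero_add] at hi hj
  rcases Nat.eq_zero_or_pos (M i j) with h0 | hpos
  · have hg : M.gram i j = -2 := by simp [CoxeterMatrix.gram, h0]
    rw [hg, show (-2 : ℝ) * -2 - 2 = 2 by norm_num, S_eval_two] at hj
    push_cast at hj
    have : (n : ℝ) = 0 := by linarith
    rw [h0, zero_dvd_iff]
    exact_mod_cast this
  have h1 : M i j ≠ 1 := M.off_diagonal i j hij
  by_cases h2 : M i j = 2
  · have hg : M.gram i j = 0 := by simp [CoxeterMatrix.gram, h2]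
    rw [hg, show (0 : ℝ) * 0 - 2 = -2 by norm_num, S_eval_neg_two, S_eval_neg_two] at hi
    rw [h2, ← even_iff_two_dvd]
    by_contra hn
    rw [Nat.not_even_iff_odd] at hn
    have o : Odd (n : ℤ) := by exact_mod_cast hn
    have e : Even ((n : ℤ) - 1) := o.sub_odd odd_one
    rw [Int.negOnePow_odd _ o, Int.negOnePow_even _ e] at hi
    push_cast at hi
    linarith
  have h3 : 3 ≤ M i j := by omega
  set m := M i j with hm
  set θ : ℝ := 2 * (Real.pi / m) with hθ
  have hmR : (3 : ℝ) ≤ m := by exact_mod_cast h3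
  have hpi := Real.pi_pos
  have hm0 : (m : ℝ) ≠ 0 := by positivity
  have hmθ : (m : ℝ) * θ = 2 * Real.pi := by rw [hθ]; field_simp
  have hsin : Real.sin θ ≠ 0 := by
    refine (Real.sin_pos_of_pos_of_lt_pi (by rw [hθ]; positivity) ?_).ne'
    nlinarith
  have hg : M.gram i j = -2 * Real.cos (Real.pi / m) := by
    rw [CoxeterMatrix.gram, if_neg hpos.ne']
  have hg0 : M.gram i j ≠ 0 := by
    rw [hg]
    refine mul_ne_zero (by norm_num) (Real.cos_pos_of_mem_Ioo ⟨?_, ?_⟩).ne'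
    · have : 0 < Real.pi / m := by positivity
      linarith
    · rw [div_lt_div_iff_of_pos_left hpi (by positivity) (by norm_num)]
      linarith
  have ht : M.gram i j * M.gram i j - 2 = 2 * Real.cos θ := by
    rw [hg, hθ, Real.cos_two_mul]; ring
  rw [ht] at hi hj
  have hz : (S ℝ (n - 1 : ℤ)).eval (2 * Real.cos θ) = 0 := by
    rcases mul_eq_zero.1 hj with h | h
    · exact h
    · exact absurd (neg_eq_zero.1 h) hg0
  -- The `e_j`-coordinate gives `sin (nθ) = 0` and the `e_i`-coordinate then gives `cos (nθ) = 1`,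
  -- so `nθ` is a multiple of `2π`.
  have hs0 : Real.sin (n * θ) = 0 := by
    have := Polynomial.Chebyshev.S_two_mul_real_cos θ (n - 1)
    rw [hz] at this
    push_cast at this
    rw [sub_add_cancel] at this
    linarith
  have hc1 : Real.cos (n * θ) = 1 := by
    have := Polynomial.Chebyshev.S_two_mul_real_cos θ n
    rw [hz, add_zero] at hi
    rw [hi, Int.cast_natCast, add_mul, one_mul, Real.sin_add, hs0, one_mul] at this
    apply mul_right_cancel₀ hsin
    linarith
  obtain ⟨k, hk⟩ := (Real.cos_eq_one_iff _).1 hc1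
  have : (n : ℝ) = k * m := by
    have h2pi : (2 * Real.pi) ≠ 0 := by positivity
    apply mul_right_cancel₀ h2pi
    calc (n : ℝ) * (2 * Real.pi) = (n * θ) * m := by rw [← hmθ]; ring
      _ = _ := by rw [← hk]; ring
  have hz' : (n : ℤ) = k * m := by exact_mod_cast this
  exact Int.natCast_dvd_natCast.1 ⟨k, by rw [hz', mul_comm]⟩

end CoxeterSystem

/-! ### Reduced words: parabolic cosets and Matsumoto's theorem -/

theorem length_alternatingFrom {S : Type*} (s t : S) (m : ℕ) :
    (alternatingFrom s t m).length = m := by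
  induction m generalizing s t with
  | zero => rfl
  | succ m ih => simp [alternatingFrom, ih]

theorem mem_alternatingFrom {S : Type*} {s t x : S} {m : ℕ} (h : x ∈ alternatingFrom s t m) :
    x = s ∨ x = t := by
  induction m generalizing s t with
  | zero => simp [alternatingFrom] at h
  | succ m ih =>
    rcases List.mem_cons.1 h with h | h
    · exact Or.inl h
    · exact (ih h).symm

theorem reverse_alternatingWord {S : Type*} (s t : S) (m : ℕ) :
    (CoxeterSystem.alternatingWord s t m).reverse = alternatingFrom t s m := by
  induction m generalizing s t with
  | zero => rfl
  | succ m ih => simp [CoxeterSystem.alternatingWord_succ, alternatingFrom, ih]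

/-- `alternatingWord` fixes the last letter and `alternatingFrom` the first, hence the dependence on
parity. -/
theorem alternatingWord_eq_ite {S : Type*} (s t : S) (m : ℕ) :
    CoxeterSystem.alternatingWord s t m =
      if Even m then alternatingFrom s t m else alternatingFrom t s m := by
  induction m with
  | zero => rfl
  | succ m ih =>
    rw [CoxeterSystem.alternatingWord_succ', ih]
    by_cases h : Even m
    · have h' : ¬ Even (m + 1) := by simp [h, parity_simps]
      simp [h, h', alternatingFrom]
    · have h' : Even (m + 1) := by simp [h, parity_simps]
      simp [h, h', alternatingFrom]

/-- Replacing a subword `p(s,t)` by `p(t,s)`. -/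
inductive CoxeterMatrix.BraidStep {B : Type*} (M : CoxeterMatrix B) : List B → List B → Prop
  | mk (l₁ l₂ : List B) (s t : B) (hst : s ≠ t) (hM : M s t ≠ 0) :
      CoxeterMatrix.BraidStep M (l₁ ++ (alternatingFrom s t (M s t) ++ l₂))
        (l₁ ++ (alternatingFrom t s (M t s) ++ l₂))

namespace CoxeterSystem

variable {B W : Type*} [Group W] {M : CoxeterMatrix B} (cs : CoxeterSystem M W)

theorem wordProd_alternatingFrom_swap (s t : B) :
    cs.wordProd (alternatingFrom s t (M s t)) = cs.wordProd (alternatingFrom t s (M t s)) := by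
  rw [← reverse_alternatingWord, ← reverse_alternatingWord, wordProd_reverse, wordProd_reverse,
    M.symmetric t s]
  have := cs.wordProd_braidWord_eq t s
  rw [braidWord, braidWord, M.symmetric t s] at this
  rw [this]

theorem wordProd_eq_of_braidStep {ω ω' : List B} (h : M.BraidStep ω ω') :
    cs.wordProd ω = cs.wordProd ω' := by
  obtain ⟨l₁, l₂, s, t, -, -⟩ := h
  simp only [wordProd_append, cs.wordProd_alternatingFrom_swap s t]

theorem _root_.CoxeterMatrix.BraidStep.length_eq {ω ω' : List B} (h : M.BraidStep ω ω') :
    ω.length = ω'.length := by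
  obtain ⟨l₁, l₂, s, t, -, -⟩ := h
  simp [length_alternatingFrom, M.symmetric s t]

theorem isReduced_of_append_left {ω ω' : List B} (h : cs.IsReduced (ω ++ ω')) :
    cs.IsReduced ω := by
  simpa using h.take ω.length

theorem isReduced_of_append_right {ω ω' : List B} (h : cs.IsReduced (ω ++ ω')) :
    cs.IsReduced ω' := by
  simpa using h.drop ω.length

theorem isReduced_append_singleton_iff {ω : List B} (hω : cs.IsReduced ω) (s : B) :
    cs.IsReduced (ω ++ [s]) ↔ ¬ cs.IsRightDescent (cs.wordProd ω) s := by
  rw [not_isRightDescent_iff, IsReduced, wordProd_append, wordProd_singleton, hω.eq]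
  simp

theorem IsReduced.of_wordProd_eq {cs : CoxeterSystem M W} {ω ω' : List B} (hω : cs.IsReduced ω)
    (h : cs.wordProd ω = cs.wordProd ω') (hl : ω'.length ≤ ω.length) : cs.IsReduced ω' :=
  le_antisymm (cs.length_wordProd_le ω') (by rw [← h, hω.eq]; exact hl)

theorem IsReduced.length_eq {cs : CoxeterSystem M W} {ω ω' : List B} (hω : cs.IsReduced ω)
    (hω' : cs.IsReduced ω') (h : cs.wordProd ω = cs.wordProd ω') : ω.length = ω'.length := by
  rw [← hω.eq, ← hω'.eq, h]

/-- By the exchange condition, a letter that makes a reduced word non-reduced cancels one of its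
letters. The control of the letters keeps reduced expressions inside a standard parabolic subgroup.
-/
theorem exists_isReduced_subset (ω : List B) :
    ∃ ω', cs.IsReduced ω' ∧ cs.wordProd ω' = cs.wordProd ω ∧ ω' ⊆ ω := by
  induction ω using List.reverseRecOn with
  | nil => exact ⟨[], by simp [IsReduced], rfl, fun _ h => h⟩
  | append_singleton ω a ih =>
    obtain ⟨ω', hr, hp, hs⟩ := ih
    by_cases h : cs.IsRightDescent (cs.wordProd ω') a
    · obtain ⟨k, hk, he⟩ := cs.exists_mul_simple_eq_eraseIdx h
      have hlen := List.length_eraseIdx_add_one hk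
      refine ⟨ω'.eraseIdx k, ?_, by rw [← he, hp, wordProd_append, wordProd_singleton], ?_⟩
      · rw [isRightDescent_iff, he, hr.eq] at h
        rw [IsReduced]
        omega
      · exact fun x hx => List.mem_append_left _ (hs (List.eraseIdx_subset hx))
    · refine ⟨ω' ++ [a], (cs.isReduced_append_singleton_iff hr a).2 h, ?_, ?_⟩
      · simp only [wordProd_append, hp]
      · exact List.append_subset.2 ⟨fun x hx => List.mem_append_left _ (hs hx), by simp⟩

/-- Each element has a reduced expression that ends in a given right descent, with the other
letters from a given word. -/
theorem exists_isReduced_append_singleton {ω : List B} (hω : cs.IsReduced ω) {s : B}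
    (h : cs.IsRightDescent (cs.wordProd ω) s) :
    ∃ ω', cs.IsReduced (ω' ++ [s]) ∧ cs.wordProd (ω' ++ [s]) = cs.wordProd ω ∧
      ω' ⊆ ω ++ [s] := by
  obtain ⟨ω', hr, hp, hs⟩ := cs.exists_isReduced_subset (ω ++ [s])
  have hp' : cs.wordProd (ω' ++ [s]) = cs.wordProd ω := by
    rw [wordProd_append, hp, wordProd_append, wordProd_singleton, mul_assoc,
      simple_mul_simple_self, mul_one]
  refine ⟨ω', hω.of_wordProd_eq hp'.symm ?_, hp', hs⟩
  have h1 := (cs.isRightDescent_iff).1 h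
  rw [wordProd_append, wordProd_singleton] at hp
  rw [← hp, hr.eq, hω.eq] at h1
  simp [h1]

/-- Decomposition of an element with respect to a coset of a standard parabolic subgroup. -/
theorem exists_minimal_coset_word (A : Set B) (w : W) :
    ∃ u v : List B, cs.IsReduced v ∧ (∀ x ∈ v, x ∈ A) ∧ cs.wordProd (u ++ v) = w ∧
      ∀ v', cs.IsReduced v' → (∀ x ∈ v', x ∈ A) → cs.IsReduced (u ++ v') := by
  -- The prefix `u` will represent an element of minimal length in the coset of `w` by the parabolic
  -- subgroup generated by `A`.
  obtain ⟨v₀, hv₀, hmin⟩ := exists_minimal_of_wellFoundedLT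
    (fun n => ∃ v : List B, (∀ x ∈ v, x ∈ A) ∧ cs.length (w * (cs.wordProd v)⁻¹) = n)
    ⟨_, [], by simp, rfl⟩
  obtain ⟨v₁, hv₁, rfl⟩ := hv₀
  obtain ⟨u, hu, hpu⟩ := cs.exists_isReduced (w * (cs.wordProd v₁)⁻¹)
  obtain ⟨v, hv, hpv, hsub⟩ := cs.exists_isReduced_subset v₁
  have hle : ∀ v' : List B, (∀ x ∈ v', x ∈ A) →
      cs.length (cs.wordProd u) ≤ cs.length (cs.wordProd u * cs.wordProd v') := by
    intro v' hv'
    have : cs.wordProd u * cs.wordProd v' = w * (cs.wordProd (v'.reverse ++ v₁))⁻¹ := by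
      rw [← hpu, wordProd_append, wordProd_reverse]; group
    have hA : ∀ x ∈ v'.reverse ++ v₁, x ∈ A := by
      intro x hx
      rcases List.mem_append.1 hx with hx | hx
      · exact hv' x (List.mem_reverse.1 hx)
      · exact hv₁ x hx
    rw [this, ← hpu]
    rcases le_total (cs.length (w * (cs.wordProd v₁)⁻¹))
      (cs.length (w * (cs.wordProd (v'.reverse ++ v₁))⁻¹)) with h | h
    · exact h
    · exact hmin ⟨_, hA, rfl⟩ h
  refine ⟨u, v, hv, fun x hx => hv₁ x (hsub hx), ?_, ?_⟩
  · rw [wordProd_append, ← hpu, hpv, inv_mul_cancel_right]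
  intro v' hr hA
  induction v' using List.reverseRecOn with
  | nil => simpa using hu
  | append_singleton v' a ih =>
    have hr' := cs.isReduced_of_append_left hr
    have hA' : ∀ x ∈ v', x ∈ A := fun x hx => hA x (List.mem_append_left _ hx)
    have huv := ih hr' hA'
    rw [← List.append_assoc, cs.isReduced_append_singleton_iff huv]
    intro hd
    obtain ⟨k, hk, he⟩ := cs.exists_mul_simple_eq_eraseIdx hd
    -- A letter deleted from `u` would give a shorter element of the same coset; a letter deleted
    -- from `v'` would show that `v' a` is not reduced.
    by_cases hku : k < u.length
    · rw [List.eraseIdx_append_of_lt_length hku, wordProd_append, wordProd_append] at he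
      have h1 : cs.wordProd u * cs.wordProd (v' ++ [a] ++ v'.reverse) =
          cs.wordProd (u.eraseIdx k) := by
        rw [wordProd_append, wordProd_append, wordProd_singleton, wordProd_reverse,
          ← mul_assoc, ← mul_assoc, he, mul_inv_cancel_right]
      have h2 := hle (v' ++ [a] ++ v'.reverse) (by
        intro x hx
        simp only [List.mem_append, List.mem_reverse] at hx
        rcases hx with hx | hx
        · exact hA x (List.mem_append.2 hx)
        · exact hA' x hx)
      rw [h1, hu.eq] at h2
      have h3 := cs.length_wordProd_le (u.eraseIdx k)
      have h4 := List.length_eraseIdx_add_one hku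
      omega
    · push Not at hku
      rw [List.eraseIdx_append_of_length_le hku, wordProd_append, wordProd_append, mul_assoc] at he
      have h1 := mul_left_cancel he
      have h2 := hr.eq
      rw [wordProd_append, wordProd_singleton, h1] at h2
      have h3 := cs.length_wordProd_le (v'.eraseIdx (k - u.length))
      have hk' : k - u.length < v'.length := by
        rw [List.length_append] at hk; omega
      have h4 := List.length_eraseIdx_add_one hk'
      rw [List.length_append] at h2
      omega

/-- A reduced word has no two equal adjacent letters. -/
theorem IsReduced.eq_alternatingWord {cs : CoxeterSystem M W} {s t : B} {ω : List B}
    (h : cs.IsReduced ω) (hA : ∀ x ∈ ω, x = s ∨ x = t) :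
    ω = alternatingWord s t ω.length ∨ ω = alternatingWord t s ω.length := by
  induction ω using List.reverseRecOn generalizing s t with
  | nil => exact Or.inl rfl
  | append_singleton ω a ih =>
    wlog hat : a = t generalizing s t
    · exact (this (fun x hx => (hA x hx).symm) ((hA a (by simp)).resolve_right hat)).symm
    subst hat
    left
    rw [List.length_append, List.length_singleton, alternatingWord_succ, List.concat_eq_append]
    congr 1
    rcases ih (cs.isReduced_of_append_left h)
      (fun x hx => hA x (List.mem_append_left _ hx)) with h1 | h1
    · rcases ω.length.eq_zero_or_pos with h0 | h0
      · rw [List.length_eq_zero_iff.1 h0]; rfl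
      · exfalso
        obtain ⟨n, hn⟩ := Nat.exists_eq_succ_of_ne_zero h0.ne'
        rw [hn, Nat.succ_eq_add_one, alternatingWord_succ, List.concat_eq_append] at h1
        rw [h1, List.append_assoc] at h
        have := cs.isReduced_of_append_right h
        simp [IsReduced, wordProd_cons] at this
    · exact h1

theorem IsReduced.eq_alternatingFrom {cs : CoxeterSystem M W} {s t : B} {ω : List B}
    (h : cs.IsReduced ω) (hA : ∀ x ∈ ω, x = s ∨ x = t) :
    ω = alternatingFrom s t ω.length ∨ ω = alternatingFrom t s ω.length := by
  rcases h.eq_alternatingWord hA with h | h <;> rw [alternatingWord_eq_ite] at h <;>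
    split_ifs at h <;> simp [← h]

theorem simple_mul_simple_pow_eq_one_of_wordProd_eq {s t : B} {n : ℕ}
    (h : cs.wordProd (alternatingWord s t n) = cs.wordProd (alternatingWord t s n)) :
    (cs.simple s * cs.simple t) ^ n = 1 := by
  have hinv : cs.simple t * cs.simple s = (cs.simple s * cs.simple t)⁻¹ := by simp
  rw [prod_alternatingWord_eq_mul_pow, prod_alternatingWord_eq_mul_pow] at h
  obtain ⟨k, rfl | rfl⟩ := Nat.even_or_odd' n
  · have e : 2 * k / 2 = k := by omega
    rw [e, if_pos (even_two_mul k), if_pos (even_two_mul k), one_mul, one_mul, hinv, inv_pow] at h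
    rw [two_mul, pow_add]
    nth_rewrite 1 [h]
    exact inv_mul_cancel _
  · have e : (2 * k + 1) / 2 = k := by omega
    have o : ¬ Even (2 * k + 1) := by simp
    rw [e, if_neg o, if_neg o] at h
    have h' := congrArg (fun x => cs.simple s * x) h
    simp only [← mul_assoc] at h'
    rw [hinv, inv_pow, ← pow_succ', simple_mul_simple_self, one_mul] at h'
    rw [show 2 * k + 1 = k + 1 + k by ring, pow_add, h', inv_mul_cancel]

/-- Two distinct right descents generate a finite dihedral group, whose longest element is a
right factor. -/
theorem exists_append_alternatingWord {s t : B} (hst : s ≠ t) {w : W}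
    (hs : cs.IsRightDescent w s) (ht : cs.IsRightDescent w t) :
    M s t ≠ 0 ∧ ∃ u : List B,
      (cs.IsReduced (u ++ alternatingWord s t (M s t)) ∧
        cs.wordProd (u ++ alternatingWord s t (M s t)) = w) ∧
      (cs.IsReduced (u ++ alternatingWord t s (M s t)) ∧
        cs.wordProd (u ++ alternatingWord t s (M s t)) = w) := by
  obtain ⟨u, v, hv, hvA, hw, hu⟩ := cs.exists_minimal_coset_word {x | x = s ∨ x = t} w
  -- As `u` is minimal in its coset, a descent `q` of `w` is a descent of the dihedral part `v`,
  -- which therefore has a reduced expression ending in `q`; in two letters this must be the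
  -- alternating word.
  have hends : ∀ p q : B, (p = s ∧ q = t ∨ p = t ∧ q = s) → cs.IsRightDescent w q →
      cs.IsReduced (alternatingWord p q v.length) ∧ 0 < v.length ∧
        cs.wordProd (alternatingWord p q v.length) = cs.wordProd v := by
    intro p q hpq hq
    have hqA : q = s ∨ q = t := by tauto
    have hd : cs.IsRightDescent (cs.wordProd v) q := by
      by_contra hn
      have h1 := (cs.isReduced_append_singleton_iff hv q).2 hn
      have h2 := hu _ h1 (by
        intro x hx
        rcases List.mem_append.1 hx with hx | hx
        · exact hvA x hx
        · rw [List.mem_singleton.1 hx]; exact hqA)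
      rw [← List.append_assoc, cs.isReduced_append_singleton_iff (hu v hv hvA), hw] at h2
      exact h2 hq
    obtain ⟨v', hr, hp, hsub⟩ := cs.exists_isReduced_append_singleton hv hd
    have hA : ∀ x ∈ v' ++ [q], x = p ∨ x = q := by
      intro x hx
      have : x = s ∨ x = t := by
        rcases List.mem_append.1 hx with hx | hx
        · rcases List.mem_append.1 (hsub hx) with hx | hx
          · exact hvA x hx
          · rw [List.mem_singleton.1 hx]; exact hqA
        · rw [List.mem_singleton.1 hx]; exact hqA
      rcases hpq with ⟨rfl, rfl⟩ | ⟨rfl, rfl⟩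
      · exact this
      · exact this.symm
    have hlen := hr.length_eq hv hp
    have hne : p ≠ q := by
      rcases hpq with ⟨rfl, rfl⟩ | ⟨rfl, rfl⟩
      · exact hst
      · exact hst.symm
    rcases hr.eq_alternatingWord hA with h | h
    · rw [hlen] at h
      rw [← h]
      refine ⟨hr, ?_, hp⟩
      rw [← hlen]; simp
    · exfalso
      rw [List.length_append, List.length_singleton, alternatingWord_succ,
        List.concat_eq_append] at h
      have := List.append_inj_right' h rfl
      exact hne (List.singleton_inj.1 this).symm
  obtain ⟨r1, hpos, p1⟩ := hends s t (Or.inl ⟨rfl, rfl⟩) ht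
  obtain ⟨r2, -, p2⟩ := hends t s (Or.inr ⟨rfl, rfl⟩) hs
  have hdvd := cs.dvd_of_simple_mul_simple_pow_eq_one hst
    (cs.simple_mul_simple_pow_eq_one_of_wordProd_eq (p1.trans p2.symm))
  -- For `M s t = 0` divisibility would force `v` to be empty, but it has a descent.
  have hM : M s t ≠ 0 := by
    intro h0
    rw [h0, zero_dvd_iff] at hdvd
    omega
  have hn : v.length = M s t := by
    refine le_antisymm ?_ (Nat.le_of_dvd hpos hdvd)
    by_contra! hlt
    exact cs.not_isReduced_alternatingWord s t hM hlt r1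
  rw [hn] at r1 r2 p1 p2
  have hmem : ∀ (p q : B) (n : ℕ), ∀ x ∈ alternatingWord p q n, x = p ∨ x = q := by
    intro p q n x hx
    rw [← List.mem_reverse, reverse_alternatingWord] at hx
    exact (mem_alternatingFrom hx).symm
  refine ⟨hM, u, ⟨hu _ r1 (hmem s t _), ?_⟩, hu _ r2 fun x hx => (hmem t s _ x hx).symm, ?_⟩
  · rw [wordProd_append, p1, ← wordProd_append, hw]
  · rw [wordProd_append, p2, ← wordProd_append, hw]

/-- Matsumoto's theorem. -/
theorem reflTransGen_braidStep {ω ω' : List B} (hω : cs.IsReduced ω) (hω' : cs.IsReduced ω')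
    (h : cs.wordProd ω = cs.wordProd ω') : Relation.ReflTransGen M.BraidStep ω ω' := by
  induction hn : ω.length generalizing ω ω' with
  | zero =>
    have hl := hω.length_eq hω' h
    rw [List.eq_nil_of_length_eq_zero hn, List.eq_nil_of_length_eq_zero (hl.symm.trans hn)]
  | succ n ih =>
    have hl := hω.length_eq hω' h
    have hsame : ∀ (u u' : List B) (a : B), cs.IsReduced (u ++ [a]) → cs.IsReduced (u' ++ [a]) →
        cs.wordProd (u ++ [a]) = cs.wordProd (u' ++ [a]) → u.length = n →
        Relation.ReflTransGen M.BraidStep (u ++ [a]) (u' ++ [a]) := by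
      intro u u' a hu hu' hp hlu
      rw [wordProd_append, wordProd_append] at hp
      refine (ih (cs.isReduced_of_append_left hu) (cs.isReduced_of_append_left hu')
        (mul_right_cancel hp) hlu).lift (· ++ [a]) ?_
      rintro _ _ ⟨l₁, l₂, s, t, hst, hM⟩
      simpa [Function.onFun] using CoxeterMatrix.BraidStep.mk l₁ (l₂ ++ [a]) s t hst hM
    obtain ⟨u, s, rfl⟩ : ∃ u s, ω = u ++ [s] :=
      ⟨_, _, (List.dropLast_append_getLast (List.ne_nil_of_length_pos (by omega))).symm⟩
    obtain ⟨u', t, rfl⟩ : ∃ u' t, ω' = u' ++ [t] :=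
      ⟨_, _, (List.dropLast_append_getLast (List.ne_nil_of_length_pos (by omega))).symm⟩
    have hlu : u.length = n := by simpa using hn
    by_cases hst : s = t
    · subst hst
      exact hsame u u' s hω hω' h hlu
    have hdesc : ∀ (x : List B) (a : B), cs.IsReduced (x ++ [a]) →
        cs.IsRightDescent (cs.wordProd (x ++ [a])) a := by
      intro x a hx
      have h1 := (cs.isReduced_append_singleton_iff (cs.isReduced_of_append_left hx) a).1 hx
      rw [isRightDescent_iff_not_isRightDescent_mul]
      simpa [wordProd_append, mul_assoc] using h1
    -- When the last letters differ, both are descents, so the element has reduced expressions `y p`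
    -- and `y p'` with `p`, `p'` the two longest alternating words. One ends in `s` and the other in
    -- `t`, so induction joins each to a given word, and one braid step joins them.
    obtain ⟨hM, y, ⟨hy1, py1⟩, hy2, py2⟩ := cs.exists_append_alternatingWord hst
      (hdesc u s hω) (by rw [h]; exact hdesc u' t hω')
    obtain ⟨m, hm⟩ := Nat.exists_eq_succ_of_ne_zero hM
    have hstep : M.BraidStep (y ++ alternatingWord t s (M s t))
        (y ++ alternatingWord s t (M s t)) := by
      rw [alternatingWord_eq_ite, alternatingWord_eq_ite]
      by_cases he : Even (M s t)
      · have := CoxeterMatrix.BraidStep.mk (M := M) y [] t s (Ne.symm hst) (M.symmetric s t ▸ hM)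
        rw [M.symmetric t s] at this
        simpa [he] using this
      · have := CoxeterMatrix.BraidStep.mk (M := M) y [] s t hst hM
        rw [M.symmetric t s] at this
        simpa [he] using this
    have e : ∀ p q, y ++ alternatingWord p q (M s t) = (y ++ alternatingWord q p m) ++ [q] := by
      intro p q
      rw [hm, Nat.succ_eq_add_one, alternatingWord_succ, List.concat_eq_append, List.append_assoc]
    rw [e] at hy1 py1 hy2 py2
    rw [e, e] at hstep
    have hl1 := hω.length_eq hy1 py1.symm
    refine (hsame u _ s hω hy2 py2.symm hlu).trans (.head hstep (hsame _ u' t hy1 hω' ?_ ?_))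
    · exact py1.trans h
    · simp only [List.length_append, List.length_singleton] at hl1 hn ⊢
      omega

end CoxeterSystem

/-! ### Galleries and homotopies -/

namespace GeneralizedChamberSystem

variable {S : Type u} {𝒲 : GeneralizedChamberSystem.{u, v, w} S}

theorem Gallery.word_nil (C : 𝒲.Chamber) :
    Gallery.word (Quiver.Path.nil : 𝒲.Gallery C C) = [] := rfl

theorem Gallery.word_cons {C D E : 𝒲.Chamber} (β : 𝒲.Gallery C D) (i : 𝒲.Edge D E) :
    Gallery.word (Quiver.Path.cons β i) = Gallery.word β ++ [i.type] := rfl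

theorem Gallery.word_comp {C D E : 𝒲.Chamber} (β : 𝒲.Gallery C D) (γ : 𝒲.Gallery D E) :
    Gallery.word (β.comp γ) = Gallery.word β ++ Gallery.word γ := by
  induction γ with
  | nil => simp [Gallery.word_nil]
  | cons γ i ih => rw [Quiver.Path.comp_cons, word_cons, word_cons, ih, List.append_assoc]

theorem Gallery.exists_eq_comp {C D : 𝒲.Chamber} {β : 𝒲.Gallery C D} {l₁ l₂ : List S}
    (h : Gallery.word β = l₁ ++ l₂) :
    ∃ (E : 𝒲.Chamber) (β₁ : 𝒲.Gallery C E) (β₂ : 𝒲.Gallery E D),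
      β = β₁.comp β₂ ∧ Gallery.word β₁ = l₁ ∧ Gallery.word β₂ = l₂ := by
  induction β generalizing l₂ with
  | nil =>
    obtain ⟨h₁, h₂⟩ := List.nil_eq_append_iff.1 h
    exact ⟨_, .nil, .nil, rfl, h₁.symm, h₂.symm⟩
  | cons β i ih =>
    rcases List.eq_nil_or_concat l₂ with rfl | ⟨l₂', a, rfl⟩
    · exact ⟨_, _, .nil, rfl, by rw [h, List.append_nil], rfl⟩
    · rw [word_cons, List.concat_eq_append, ← List.append_assoc] at h
      obtain ⟨h₁, h₂⟩ := List.append_inj' h rfl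
      obtain ⟨E, β₁, β₂, rfl, e₁, e₂⟩ := ih h₁
      refine ⟨E, β₁, Quiver.Path.cons β₂ i, rfl, e₁, ?_⟩
      rw [word_cons, e₂, h₂, List.concat_eq_append]

theorem Gallery.exists_eq_cons {C D : 𝒲.Chamber} {β : 𝒲.Gallery C D} {l : List S} {s : S}
    (h : Gallery.word β = l ++ [s]) :
    ∃ (E : 𝒲.Chamber) (β₁ : 𝒲.Gallery C E) (j : 𝒲.Arrow s E D) (hj : ¬ IsTrivialArrow j),
      β = Quiver.Path.cons β₁ (Edge.mk s j hj) ∧ Gallery.word β₁ = l := by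
  cases β with
  | nil => simp [word_nil] at h
  | cons β i =>
    rw [word_cons] at h
    obtain ⟨h₁, h₂⟩ := List.append_inj' h rfl
    obtain rfl := List.singleton_inj.1 h₂
    exact ⟨_, β, i.arrow, i.nontrivial, rfl, h₁⟩

/-! ### Extending a gallery by a possibly trivial arrow -/

section Arrow

variable {s : S} {C D E F : 𝒲.Chamber}

theorem id_compArrow (a : 𝒲.Arrow s C D) : compArrow (𝒲.idArrow s C) a = a :=
  (𝒲.panelGroupoid s).id_comp a

theorem compArrow_id (a : 𝒲.Arrow s C D) : compArrow a (𝒲.idArrow s D) = a :=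
  (𝒲.panelGroupoid s).comp_id a

theorem compArrow_assoc (a : 𝒲.Arrow s C D) (b : 𝒲.Arrow s D E) (c : 𝒲.Arrow s E F) :
    compArrow (compArrow a b) c = compArrow a (compArrow b c) :=
  (𝒲.panelGroupoid s).assoc a b c

theorem compArrow_inv (a : 𝒲.Arrow s C D) : compArrow a (invArrow a) = 𝒲.idArrow s C :=
  (𝒲.panelGroupoid s).comp_inv a

theorem invArrow_comp (a : 𝒲.Arrow s C D) : compArrow (invArrow a) a = 𝒲.idArrow s D :=
  (𝒲.panelGroupoid s).inv_comp a

theorem isTrivialArrow_id (s : S) (C : 𝒲.Chamber) : IsTrivialArrow (𝒲.idArrow s C) :=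
  ⟨rfl, rfl⟩

open Classical in
/-- Extend a gallery by an arrow of a panel groupoid: append the corresponding edge, unless the
arrow is trivial. -/
noncomputable def Gallery.snoc (γ : 𝒲.Gallery C D) (a : 𝒲.Arrow s D E) : 𝒲.Gallery C E :=
  if h : IsTrivialArrow a then h.choose ▸ γ else Quiver.Path.cons γ (Edge.mk s a h)

theorem Gallery.snoc_id (γ : 𝒲.Gallery C D) : Gallery.snoc γ (𝒲.idArrow s D) = γ := by
  rw [snoc, dif_pos (isTrivialArrow_id s D)]

theorem Gallery.snoc_of_not_isTrivialArrow (γ : 𝒲.Gallery C D) {a : 𝒲.Arrow s D E}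
    (h : ¬ IsTrivialArrow a) : Gallery.snoc γ a = Quiver.Path.cons γ (Edge.mk s a h) :=
  dif_neg h

theorem Gallery.comp_snoc (β : 𝒲.Gallery C D) (γ : 𝒲.Gallery D E) (a : 𝒲.Arrow s E F) :
    β.comp (Gallery.snoc γ a) = Gallery.snoc (β.comp γ) a := by
  by_cases h : IsTrivialArrow a
  · obtain ⟨rfl, rfl⟩ := h
    exact (congrArg _ (snoc_id γ)).trans (snoc_id _).symm
  · rw [snoc_of_not_isTrivialArrow _ h, snoc_of_not_isTrivialArrow _ h, Quiver.Path.comp_cons]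

theorem Gallery.word_snoc (γ : 𝒲.Gallery C D) (a : 𝒲.Arrow s D E) :
    Gallery.word (Gallery.snoc γ a) = Gallery.word γ ∨
      Gallery.word (Gallery.snoc γ a) = Gallery.word γ ++ [s] := by
  by_cases h : IsTrivialArrow a
  · obtain ⟨rfl, rfl⟩ := h
    exact Or.inl (congrArg _ (snoc_id γ))
  · rw [snoc_of_not_isTrivialArrow _ h]
    exact Or.inr rfl

end Arrow

end GeneralizedChamberSystem

namespace WeylData

variable {S : Type u} {M : CoxeterMatrix S} {𝒲 : WeylData.{u, v, w} M}

/-! ### Homotopy is compatible with concatenation -/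

section Homotopic

variable {C D E : 𝒲.Chamber}

theorem Homotopic.symm {β β' : 𝒲.Gallery C D} (h : Homotopic β β') : Homotopic β' β :=
  Relation.EqvGen.symm _ _ h

theorem Homotopic.trans {β β' β'' : 𝒲.Gallery C D} (h : Homotopic β β')
    (h' : Homotopic β' β'') : Homotopic β β'' :=
  Relation.EqvGen.trans _ _ _ h h'

theorem Homotopic.refl (β : 𝒲.Gallery C D) : Homotopic β β :=
  Relation.EqvGen.refl _

theorem Contraction.comp_left (γ : 𝒲.Gallery C D) {β β' : 𝒲.Gallery D E}
    (h : Contraction β β') : Contraction (γ.comp β) (γ.comp β') := by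
  cases h with
  | backtrack β i β' =>
    simpa only [Quiver.Path.comp_assoc] using Contraction.backtrack (γ.comp β) i β'
  | shortcut β s j j' β' hj hj' hjj' =>
    simpa only [Quiver.Path.comp_assoc] using
      Contraction.shortcut (γ.comp β) s j j' β' hj hj' hjj'
  | suite β s t θ β' hθ =>
    simpa only [Quiver.Path.comp_assoc] using Contraction.suite (γ.comp β) s t θ β' hθ

theorem Contraction.comp_right {β β' : 𝒲.Gallery C D} (h : Contraction β β')
    (γ : 𝒲.Gallery D E) : Contraction (β.comp γ) (β'.comp γ) := by
  cases h with
  | backtrack β i β' =>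
    simpa only [Quiver.Path.comp_assoc] using Contraction.backtrack β i (β'.comp γ)
  | shortcut β s j j' β' hj hj' hjj' =>
    simpa only [Quiver.Path.comp_assoc] using
      Contraction.shortcut β s j j' (β'.comp γ) hj hj' hjj'
  | suite β s t θ β' hθ =>
    simpa only [Quiver.Path.comp_assoc] using Contraction.suite β s t θ (β'.comp γ) hθ

theorem Homotopic.comp_left (γ : 𝒲.Gallery C D) {β β' : 𝒲.Gallery D E}
    (h : Homotopic β β') : Homotopic (γ.comp β) (γ.comp β') := by
  induction h with
  | rel _ _ h => exact .rel _ _ (h.comp_left γ)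
  | refl _ => exact .refl _
  | symm _ _ _ ih => exact ih.symm
  | trans _ _ _ _ _ ih ih' => exact ih.trans ih'

theorem Homotopic.comp_right {β β' : 𝒲.Gallery C D} (h : Homotopic β β')
    (γ : 𝒲.Gallery D E) : Homotopic (β.comp γ) (β'.comp γ) := by
  induction h with
  | rel _ _ h => exact .rel _ _ (h.comp_right γ)
  | refl _ => exact .refl _
  | symm _ _ _ ih => exact ih.symm
  | trans _ _ _ _ _ ih ih' => exact ih.trans ih'

theorem Homotopic.snoc {s : S} {β β' : 𝒲.Gallery C D} (h : Homotopic β β')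
    (a : 𝒲.Arrow s D E) : Homotopic (Gallery.snoc β a) (Gallery.snoc β' a) := by
  have := h.comp_right (Gallery.snoc .nil a)
  rwa [Gallery.comp_snoc, Gallery.comp_snoc] at this

/-- This treats backtracks (`a ; b` trivial) and shortcuts (`a ; b` not trivial) uniformly. -/
theorem homotopic_snoc_snoc {s : S} {F : 𝒲.Chamber} (γ : 𝒲.Gallery C D) (a : 𝒲.Arrow s D E)
    (b : 𝒲.Arrow s E F) :
    Homotopic (Gallery.snoc (Gallery.snoc γ a) b) (Gallery.snoc γ (compArrow a b)) := by
  by_cases ha : IsTrivialArrow a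
  · obtain ⟨rfl, rfl⟩ := ha
    change Homotopic (Gallery.snoc (Gallery.snoc γ (𝒲.idArrow s D)) b)
      (Gallery.snoc γ (compArrow (𝒲.idArrow s D) b))
    rw [Gallery.snoc_id, id_compArrow]
    exact .refl _
  by_cases hb : IsTrivialArrow b
  · obtain ⟨rfl, rfl⟩ := hb
    change Homotopic (Gallery.snoc (Gallery.snoc γ a) (𝒲.idArrow s E))
      (Gallery.snoc γ (compArrow a (𝒲.idArrow s E)))
    rw [Gallery.snoc_id, compArrow_id]
    exact .refl _
  rw [Gallery.snoc_of_not_isTrivialArrow _ ha, Gallery.snoc_of_not_isTrivialArrow _ hb]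
  by_cases hab : IsTrivialArrow (compArrow a b)
  · obtain ⟨rfl, -⟩ := id hab
    obtain rfl := (isTrivialArrow_comp_iff a b).1 hab
    rw [compArrow_inv, Gallery.snoc_id]
    exact .rel _ _ (.backtrack γ ⟨s, a, ha⟩ .nil)
  · rw [Gallery.snoc_of_not_isTrivialArrow _ hab]
    exact .rel _ _ (.shortcut γ s a b .nil ha hb hab)

end Homotopic

/-! ### Strict homotopies and braid moves -/

section StrictlyHomotopic

variable {C D E : 𝒲.Chamber}

theorem StrictlyHomotopic.refl (β : 𝒲.Gallery C D) : StrictlyHomotopic β β :=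
  Relation.ReflTransGen.refl

theorem StrictlyHomotopic.trans {β β' β'' : 𝒲.Gallery C D} (h : StrictlyHomotopic β β')
    (h' : StrictlyHomotopic β' β'') : StrictlyHomotopic β β'' :=
  Relation.ReflTransGen.trans h h'

theorem ElementaryStrictHomotopy.symm {β β' : 𝒲.Gallery C D}
    (h : ElementaryStrictHomotopy β β') : ElementaryStrictHomotopy β' β := by
  obtain ⟨β, s, t, ρ, ρ', β', hρ, hρ', h⟩ := h
  exact ⟨β, t, s, ρ', ρ, β', hρ', hρ, h.symm⟩

theorem StrictlyHomotopic.symm {β β' : 𝒲.Gallery C D} (h : StrictlyHomotopic β β') :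
    StrictlyHomotopic β' β := by
  induction h with
  | refl => exact .refl _
  | tail _ h ih => exact Relation.ReflTransGen.head h.symm ih

theorem ElementaryStrictHomotopy.comp_left (γ : 𝒲.Gallery C D) {β β' : 𝒲.Gallery D E}
    (h : ElementaryStrictHomotopy β β') :
    ElementaryStrictHomotopy (γ.comp β) (γ.comp β') := by
  obtain ⟨β, s, t, ρ, ρ', β', hρ, hρ', h⟩ := h
  simpa only [Quiver.Path.comp_assoc] using
    ElementaryStrictHomotopy.mk (γ.comp β) s t ρ ρ' β' hρ hρ' h

theorem ElementaryStrictHomotopy.comp_right {β β' : 𝒲.Gallery C D}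
    (h : ElementaryStrictHomotopy β β') (γ : 𝒲.Gallery D E) :
    ElementaryStrictHomotopy (β.comp γ) (β'.comp γ) := by
  obtain ⟨β, s, t, ρ, ρ', β', hρ, hρ', h⟩ := h
  rw [Quiver.Path.comp_assoc, Quiver.Path.comp_assoc, Quiver.Path.comp_assoc,
    Quiver.Path.comp_assoc]
  exact ⟨β, s, t, ρ, ρ', _, hρ, hρ', h⟩

theorem StrictlyHomotopic.comp_left (γ : 𝒲.Gallery C D) {β β' : 𝒲.Gallery D E}
    (h : StrictlyHomotopic β β') : StrictlyHomotopic (γ.comp β) (γ.comp β') :=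
  Relation.ReflTransGen.lift (fun β : 𝒲.Gallery D E => γ.comp β)
    (fun _ _ h => ElementaryStrictHomotopy.comp_left γ h) _ _ h

theorem StrictlyHomotopic.comp_right {β β' : 𝒲.Gallery C D} (h : StrictlyHomotopic β β')
    (γ : 𝒲.Gallery D E) : StrictlyHomotopic (β.comp γ) (β'.comp γ) :=
  Relation.ReflTransGen.lift (fun β : 𝒲.Gallery C D => β.comp γ)
    (fun _ _ h => ElementaryStrictHomotopy.comp_right h γ) _ _ h

theorem StrictlyHomotopic.snoc {s : S} {β β' : 𝒲.Gallery C D} (h : StrictlyHomotopic β β')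
    (a : 𝒲.Arrow s D E) : StrictlyHomotopic (Gallery.snoc β a) (Gallery.snoc β' a) := by
  have := h.comp_right (Gallery.snoc .nil a)
  rwa [Gallery.comp_snoc, Gallery.comp_snoc] at this

theorem ElementaryStrictHomotopy.homotopic {β β' : 𝒲.Gallery C D}
    (h : ElementaryStrictHomotopy β β') : Homotopic β β' := by
  obtain ⟨β, s, t, ρ, ρ', β', -, -, h⟩ := h
  exact (h.comp_right β').comp_left β

theorem StrictlyHomotopic.homotopic {β β' : 𝒲.Gallery C D} (h : StrictlyHomotopic β β') :
    Homotopic β β' := by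
  induction h with
  | refl => exact .refl _
  | tail _ h ih => exact ih.trans h.homotopic

theorem ElementaryStrictHomotopy.braidStep {β β' : 𝒲.Gallery C D}
    (h : ElementaryStrictHomotopy β β') : M.BraidStep (word β) (word β') := by
  obtain ⟨β, s, t, ρ, ρ', β', hρ, hρ', -⟩ := h
  simp only [word, Gallery.word_comp]
  rw [show Gallery.word ρ = _ from hρ.2.2, show Gallery.word ρ' = _ from hρ'.2.2]
  exact ⟨_, _, s, t, hρ.1, hρ.2.1⟩

theorem StrictlyHomotopic.wLength_eq {β β' : 𝒲.Gallery C D} (h : StrictlyHomotopic β β') :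
    wLength β = wLength β' := by
  induction h with
  | refl => rfl
  | tail _ h ih => exact ih.trans (M.toCoxeterSystem.wordProd_eq_of_braidStep h.braidStep)

/-- The pre-Weyl condition is exactly what lifts a braid move on types to galleries; with
Matsumoto's theorem, every reduced expression of the `W`-length is then realized. -/
theorem exists_strictlyHomotopic_of_braidStep (hpw : 𝒲.IsPreWeylGraph) {β : 𝒲.Gallery C D}
    {ω : List S} (h : M.BraidStep (word β) ω) :
    ∃ β' : 𝒲.Gallery C D, word β' = ω ∧ StrictlyHomotopic β β' := by
  generalize hw : word β = ω₀ at h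
  obtain ⟨l₁, l₂, s, t, hst, hM⟩ := h
  obtain ⟨D', β₁, β₂, rfl, h₁, h₂⟩ := Gallery.exists_eq_comp hw
  obtain ⟨E', ρ, β₃, rfl, h₃, h₄⟩ := Gallery.exists_eq_comp h₂
  obtain ⟨ρ', hρ', hh⟩ := hpw.pw1 s t ρ ⟨hst, hM, h₃⟩
  refine ⟨β₁.comp (ρ'.comp β₃), ?_, .single ⟨β₁, s, t, ρ, ρ', β₃, ⟨hst, hM, h₃⟩, hρ', hh⟩⟩
  have := hρ'.2.2
  simp only [word] at this
  simp only [word, Gallery.word_comp, h₁, h₄, this]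

/-- A geodesic is strictly homotopic to a geodesic of any given reduced type that represents its
`W`-length. -/
theorem IsGeodesic.exists_strictlyHomotopic (hpw : 𝒲.IsPreWeylGraph) {γ : 𝒲.Gallery C D}
    (hγ : IsGeodesic γ) {ω : List S} (hω : M.toCoxeterSystem.IsReduced ω)
    (h : M.toCoxeterSystem.wordProd ω = wLength γ) :
    ∃ γ' : 𝒲.Gallery C D, word γ' = ω ∧ StrictlyHomotopic γ γ' := by
  have key := M.toCoxeterSystem.reflTransGen_braidStep hγ hω h.symm
  clear h hω
  induction key with
  | refl => exact ⟨γ, rfl, .refl _⟩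
  | tail _ h ih =>
    obtain ⟨γ₁, rfl, h₁⟩ := ih
    obtain ⟨γ₂, h₂, h₃⟩ := exists_strictlyHomotopic_of_braidStep hpw h
    exact ⟨γ₂, h₂, h₁.trans h₃⟩

end StrictlyHomotopic

/-- If the `W`-length of a gallery whose type is a prefix of the reduced word `ω` depends only on
its homotopy class, then homotopic galleries of type `ω` are equal. -/
theorem eq_of_homotopic_of_wLength_eq {C : 𝒲.Chamber} {ω : List S}
    (hω : M.toCoxeterSystem.IsReduced ω)
    -- Only prefixes of `ω` matter, so this can be supplied by property (W), or by the 2-Weyl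
    -- condition when `ω` is alternating.
    (hW : ∀ {D : 𝒲.Chamber} (γ γ' : 𝒲.Gallery C D), word γ <+: ω → word γ' <+: ω →
      Homotopic γ γ' → wLength γ = wLength γ')
    {D : 𝒲.Chamber} {γ γ' : 𝒲.Gallery C D} (hγ : word γ = ω) (hγ' : word γ' = ω)
    (h : Homotopic γ γ') : γ = γ' := by
  induction ω using List.reverseRecOn generalizing D with
  | nil =>
    cases γ with
    | nil =>
      cases γ' with
      | nil => rfl
      | cons β' i' => simp [word, Gallery.word_cons] at hγ'
    | cons β i => simp [word, Gallery.word_cons] at hγ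
  | append_singleton ω s ih =>
    have ih' := fun {D : 𝒲.Chamber} {γ γ' : 𝒲.Gallery C D} =>
      ih (M.toCoxeterSystem.isReduced_of_append_left hω)
      (fun γ γ' h h' => hW γ γ' (h.trans (List.prefix_append _ _))
        (h'.trans (List.prefix_append _ _))) (D := D) (γ := γ) (γ' := γ')
    obtain ⟨E, β, j, hj, rfl, hβ⟩ := Gallery.exists_eq_cons hγ
    obtain ⟨E', β', j', hj', rfl, hβ'⟩ := Gallery.exists_eq_cons hγ'
    rw [← Gallery.snoc_of_not_isTrivialArrow, ← Gallery.snoc_of_not_isTrivialArrow] at h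
    have h₁ : Homotopic (Gallery.snoc β (compArrow j (invArrow j'))) β' := by
      refine (homotopic_snoc_snoc β j (invArrow j')).symm.trans ((h.snoc _).trans ?_)
      refine (homotopic_snoc_snoc β' j' (invArrow j')).trans ?_
      rw [compArrow_inv, Gallery.snoc_id]
      exact .refl _
    by_cases ht : IsTrivialArrow (compArrow j (invArrow j'))
    · obtain ⟨rfl, he⟩ := ht
      have he' : compArrow j (invArrow j') = 𝒲.idArrow s E := he
      rw [he', Gallery.snoc_id] at h₁
      obtain rfl := ih' hβ hβ' h₁
      have : j = j' := by
        rw [← compArrow_id j, ← invArrow_comp j', ← compArrow_assoc, he', id_compArrow]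
      subst this
      rfl
    -- Here a gallery of type `ω s` is homotopic to one of type `ω`, and equal `W`-lengths would
    -- give `s = 1`.
    · exfalso
      rw [Gallery.snoc_of_not_isTrivialArrow _ ht] at h₁
      have h₂ := hW _ _ (by simp [word, Gallery.word_cons, hβ])
        (by simp [word, hβ']) h₁
      rw [wLength, wLength, word, word, Gallery.word_cons, hβ, hβ',
        CoxeterSystem.wordProd_append, mul_eq_left, CoxeterSystem.wordProd_singleton] at h₂
      have := M.toCoxeterSystem.length_simple s
      rw [h₂] at this
      simp at this

end WeylData

/-! ### The action of galleries on strict homotopy classes of geodesics -/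

namespace WeylData

variable {S : Type u} {M : CoxeterMatrix S} {𝒲 : WeylData.{u, v, w} M}

variable (𝒲) in
/-- Strict homotopy as an equivalence relation on the geodesics from `C` to `D`. -/
def geodesicSetoid (C D : 𝒲.Chamber) : Setoid {γ : 𝒲.Gallery C D // IsGeodesic γ} where
  r γ γ' := StrictlyHomotopic γ.1 γ'.1
  iseqv := ⟨fun _ => .refl _, fun h => h.symm, fun h h' => h.trans h'⟩

variable (𝒲) in
/-- The strict homotopy classes of geodesics from `C` to `D`. -/
def GeodesicClass (C D : 𝒲.Chamber) : Type _ := Quotient (𝒲.geodesicSetoid C D)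

/-- The strict homotopy class of a geodesic. -/
def GeodesicClass.mk {C D : 𝒲.Chamber} (γ : 𝒲.Gallery C D) (hγ : IsGeodesic γ) :
    𝒲.GeodesicClass C D :=
  Quotient.mk (𝒲.geodesicSetoid C D) ⟨γ, hγ⟩

theorem GeodesicClass.mk_eq_mk_iff {C D : 𝒲.Chamber} {γ γ' : 𝒲.Gallery C D}
    {hγ : IsGeodesic γ} {hγ' : IsGeodesic γ'} :
    mk γ hγ = mk γ' hγ' ↔ StrictlyHomotopic γ γ' :=
  Quotient.eq (r := 𝒲.geodesicSetoid C D)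

theorem isGeodesic_nil (C : 𝒲.Chamber) : IsGeodesic (Quiver.Path.nil : 𝒲.Gallery C C) := by
  change M.toCoxeterSystem.IsReduced []
  simp [CoxeterSystem.IsReduced]

/-! ### The action of a single arrow -/

section Snoc

variable {B C D E : 𝒲.Chamber} {s : S}

theorem isGeodesic_snoc {γ : 𝒲.Gallery C D}
    (hγ : M.toCoxeterSystem.IsReduced (word γ ++ [s])) (a : 𝒲.Arrow s D E) :
    IsGeodesic (Gallery.snoc γ a) := by
  rcases Gallery.word_snoc γ a with h | h
  · rw [IsGeodesic, word, h]
    exact M.toCoxeterSystem.isReduced_of_append_left hγ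
  · rw [IsGeodesic, word, h]
    exact hγ

/-- `y` is obtained from `x` by the arrow `a` of type `s`: there is a gallery `γ`, whose
`W`-length does not have `s` as a descent, such that `x` and `y` extend `γ` by an arrow of type
`s`, and these arrows differ by `a`. -/
def ArrowRel (a : 𝒲.Arrow s D E) (x : 𝒲.GeodesicClass C D) (y : 𝒲.GeodesicClass C E) : Prop :=
  ∃ (B : 𝒲.Chamber) (γ : 𝒲.Gallery C B) (hγ : M.toCoxeterSystem.IsReduced (word γ ++ [s]))
    (b : 𝒲.Arrow s B D), x = .mk (Gallery.snoc γ b) (isGeodesic_snoc hγ b) ∧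
      y = .mk (Gallery.snoc γ (compArrow b a)) (isGeodesic_snoc hγ _)

/-- Each geodesic is strictly homotopic to an extension, by an arrow of type `s`, of a gallery
whose `W`-length does not have `s` as a descent. -/
theorem IsGeodesic.exists_strictlyHomotopic_snoc (hpw : 𝒲.IsPreWeylGraph) (s : S)
    {γ : 𝒲.Gallery C D} (hγ : IsGeodesic γ) :
    ∃ (B : 𝒲.Chamber) (γ' : 𝒲.Gallery C B) (b : 𝒲.Arrow s B D),
      M.toCoxeterSystem.IsReduced (word γ' ++ [s]) ∧ word γ' ⊆ word γ ++ [s] ∧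
        StrictlyHomotopic γ (Gallery.snoc γ' b) := by
  by_cases hd : M.toCoxeterSystem.IsRightDescent (wLength γ) s
  · obtain ⟨ω, hω, hp, hsub⟩ := M.toCoxeterSystem.exists_isReduced_append_singleton hγ hd
    obtain ⟨γ', hw, hs⟩ := hγ.exists_strictlyHomotopic hpw hω hp
    obtain ⟨B, β, j, hj, rfl, rfl⟩ := Gallery.exists_eq_cons hw
    refine ⟨B, β, j, hω, hsub, ?_⟩
    rwa [Gallery.snoc_of_not_isTrivialArrow _ hj]
  · refine ⟨D, γ, 𝒲.idArrow s D, (M.toCoxeterSystem.isReduced_append_singleton_iff hγ s).2 hd,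
      List.subset_append_left _ _, ?_⟩
    rw [Gallery.snoc_id]
    exact .refl _

theorem exists_eq_mk_snoc (hpw : 𝒲.IsPreWeylGraph) (s : S) (x : 𝒲.GeodesicClass C D) :
    ∃ (B : 𝒲.Chamber) (γ : 𝒲.Gallery C B) (hγ : M.toCoxeterSystem.IsReduced (word γ ++ [s]))
      (b : 𝒲.Arrow s B D), x = .mk (Gallery.snoc γ b) (isGeodesic_snoc hγ b) := by
  obtain ⟨⟨γ, hγ⟩, rfl⟩ := Quotient.exists_rep x
  obtain ⟨B, γ', b, hγ', -, h⟩ := hγ.exists_strictlyHomotopic_snoc hpw s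
  exact ⟨B, γ', hγ', b, GeodesicClass.mk_eq_mk_iff.2 h⟩

theorem exists_arrowRel (hpw : 𝒲.IsPreWeylGraph) (a : 𝒲.Arrow s D E)
    (x : 𝒲.GeodesicClass C D) : ∃ y, ArrowRel a x y := by
  obtain ⟨B, γ, hγ, b, rfl⟩ := exists_eq_mk_snoc hpw s x
  exact ⟨_, B, γ, hγ, b, rfl, rfl⟩

/-- Strict homotopy preserves `W`-length, and `s` is a right descent on one side but not on the
other. Hence in a decomposition of a class, the class decides whether the final arrow is trivial. -/
theorem not_strictlyHomotopic_cons {γ : 𝒲.Gallery C D} {γ' : 𝒲.Gallery C E}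
    (hγ : M.toCoxeterSystem.IsReduced (word γ ++ [s]))
    (hγ' : M.toCoxeterSystem.IsReduced (word γ' ++ [s])) (b : 𝒲.Arrow s E D)
    (hb : ¬ IsTrivialArrow b) :
    ¬ StrictlyHomotopic γ (Quiver.Path.cons γ' (Edge.mk s b hb)) := by
  intro h
  have hp : M.toCoxeterSystem.wordProd (word γ) =
      M.toCoxeterSystem.wordProd (word γ' ++ [s]) := h.wLength_eq
  have h₁ := hγ.length_eq (ω' := word γ') (M.toCoxeterSystem.isReduced_of_append_left hγ') <| by
    rw [CoxeterSystem.wordProd_append, hp, CoxeterSystem.wordProd_append, mul_assoc,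
      CoxeterSystem.wordProd_singleton, CoxeterSystem.simple_mul_simple_self, mul_one]
  have h₂ := (M.toCoxeterSystem.isReduced_of_append_left hγ).length_eq hγ' hp
  simp only [List.length_append, List.length_singleton] at h₁ h₂
  omega

/-- Property (SH) enters here: up to strict homotopy of `γ`, a class determines both `γ` and the
final arrow `b`. -/
theorem ArrowRel.unique (hpw : 𝒲.IsPreWeylGraph) (hSH : 𝒲.PropertySH) {a : 𝒲.Arrow s D E}
    {x : 𝒲.GeodesicClass C D} {y y' : 𝒲.GeodesicClass C E} (h : ArrowRel a x y)
    (h' : ArrowRel a x y') : y = y' := by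
  obtain ⟨B, γ, hγ, b, rfl, rfl⟩ := h
  obtain ⟨B', γ', hγ', b', hx, rfl⟩ := h'
  rw [GeodesicClass.mk_eq_mk_iff] at hx ⊢
  by_cases hb : IsTrivialArrow b
  · obtain ⟨rfl, rfl⟩ := hb
    change StrictlyHomotopic (Gallery.snoc γ (𝒲.idArrow s B)) _ at hx
    change StrictlyHomotopic (Gallery.snoc γ (compArrow (𝒲.idArrow s B) a)) _
    rw [Gallery.snoc_id] at hx
    rw [id_compArrow]
    by_cases hb' : IsTrivialArrow b'
    · obtain ⟨rfl, rfl⟩ := hb'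
      change StrictlyHomotopic _ (Gallery.snoc γ' (𝒲.idArrow s B')) at hx
      change StrictlyHomotopic _ (Gallery.snoc γ' (compArrow (𝒲.idArrow s B') a))
      rw [Gallery.snoc_id] at hx
      rw [id_compArrow]
      exact hx.snoc a
    · rw [Gallery.snoc_of_not_isTrivialArrow _ hb'] at hx
      exact absurd hx (not_strictlyHomotopic_cons hγ hγ' b' hb')
  · rw [Gallery.snoc_of_not_isTrivialArrow _ hb] at hx
    by_cases hb' : IsTrivialArrow b'
    · obtain ⟨rfl, rfl⟩ := hb'
      change StrictlyHomotopic _ (Gallery.snoc γ' (𝒲.idArrow s B')) at hx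
      rw [Gallery.snoc_id] at hx
      exact absurd hx.symm (not_strictlyHomotopic_cons hγ' hγ b hb)
    · rw [Gallery.snoc_of_not_isTrivialArrow _ hb'] at hx
      have hp : M.toCoxeterSystem.wordProd (word γ ++ [s]) =
        M.toCoxeterSystem.wordProd (word γ' ++ [s]) := hx.wLength_eq
      rw [CoxeterSystem.wordProd_append, CoxeterSystem.wordProd_append] at hp
      -- Both `γ` and `γ'` have the same `W`-length, so `γ'` can be moved to the type of `γ`; then
      -- (SH) applies to the two extended galleries.
      obtain ⟨γ'', hw, hh⟩ := IsGeodesic.exists_strictlyHomotopic hpw (γ := γ')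
        (M.toCoxeterSystem.isReduced_of_append_left hγ')
        (M.toCoxeterSystem.isReduced_of_append_left hγ) (mul_right_cancel hp)
      have h₁ := hh.snoc b'
      rw [Gallery.snoc_of_not_isTrivialArrow _ hb', Gallery.snoc_of_not_isTrivialArrow _ hb'] at h₁
      have hw' : Gallery.word γ'' = Gallery.word γ := hw
      have h₂ := hSH (Quiver.Path.cons γ (Edge.mk s b hb)) _ hγ
        (by rw [IsGeodesic, word, Gallery.word_cons, hw']; exact hγ)
        (by rw [word, word, Gallery.word_cons, Gallery.word_cons, hw']) (hx.trans h₁)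
      obtain ⟨rfl, h₃, h₄⟩ := Quiver.Path.cons.inj h₂
      obtain rfl := eq_of_heq h₃
      obtain rfl := eq_of_heq (Edge.mk.inj (eq_of_heq h₄)).2
      exact hh.symm.snoc _

/-- The action of an arrow of a panel groupoid on strict homotopy classes of geodesics. -/
noncomputable def actArrow (hpw : 𝒲.IsPreWeylGraph) (a : 𝒲.Arrow s D E)
    (x : 𝒲.GeodesicClass C D) : 𝒲.GeodesicClass C E :=
  (exists_arrowRel hpw a x).choose

theorem actArrow_mk_snoc (hpw : 𝒲.IsPreWeylGraph) (hSH : 𝒲.PropertySH) (a : 𝒲.Arrow s D E)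
    {γ : 𝒲.Gallery C B} (hγ : M.toCoxeterSystem.IsReduced (word γ ++ [s])) (b : 𝒲.Arrow s B D) :
    actArrow hpw a (.mk (Gallery.snoc γ b) (isGeodesic_snoc hγ b)) =
      .mk (Gallery.snoc γ (compArrow b a)) (isGeodesic_snoc hγ _) :=
  (exists_arrowRel hpw a _).choose_spec.unique hpw hSH ⟨B, γ, hγ, b, rfl, rfl⟩

theorem actArrow_mk (hpw : 𝒲.IsPreWeylGraph) (hSH : 𝒲.PropertySH) (a : 𝒲.Arrow s D E)
    {γ : 𝒲.Gallery C D} (hγ : M.toCoxeterSystem.IsReduced (word γ ++ [s])) :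
    actArrow hpw a (.mk γ (M.toCoxeterSystem.isReduced_of_append_left hγ)) =
      .mk (Gallery.snoc γ a) (isGeodesic_snoc hγ _) := by
  have := actArrow_mk_snoc hpw hSH a hγ (𝒲.idArrow s D)
  simpa only [Gallery.snoc_id, id_compArrow] using this

theorem actArrow_id (hpw : 𝒲.IsPreWeylGraph) (hSH : 𝒲.PropertySH) (x : 𝒲.GeodesicClass C D) :
    actArrow hpw (𝒲.idArrow s D) x = x := by
  obtain ⟨B, γ, hγ, b, rfl⟩ := exists_eq_mk_snoc hpw s x
  rw [actArrow_mk_snoc hpw hSH _ hγ]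
  simp only [compArrow_id]

theorem actArrow_actArrow {F : 𝒲.Chamber} (hpw : 𝒲.IsPreWeylGraph) (hSH : 𝒲.PropertySH)
    (a : 𝒲.Arrow s D E) (b : 𝒲.Arrow s E F) (x : 𝒲.GeodesicClass C D) :
    actArrow hpw b (actArrow hpw a x) = actArrow hpw (compArrow a b) x := by
  obtain ⟨B, γ, hγ, c, rfl⟩ := exists_eq_mk_snoc hpw s x
  rw [actArrow_mk_snoc hpw hSH _ hγ, actArrow_mk_snoc hpw hSH _ hγ, actArrow_mk_snoc hpw hSH _ hγ]
  simp only [compArrow_assoc]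

end Snoc

/-- The action of galleries on strict homotopy classes of geodesics. -/
noncomputable def actGallery (hpw : 𝒲.IsPreWeylGraph) {C D : 𝒲.Chamber} :
    ∀ {E : 𝒲.Chamber}, 𝒲.Gallery D E → 𝒲.GeodesicClass C D → 𝒲.GeodesicClass C E
  | _, .nil, x => x
  | _, .cons β i, x => actArrow hpw (Edge.arrow i) (actGallery hpw β x)

theorem actGallery_comp (hpw : 𝒲.IsPreWeylGraph) {C D E F : 𝒲.Chamber} (β : 𝒲.Gallery D E)
    (β' : 𝒲.Gallery E F) (x : 𝒲.GeodesicClass C D) :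
    actGallery hpw (β.comp β') x = actGallery hpw β' (actGallery hpw β x) := by
  induction β' with
  | nil => rfl
  | cons β' i ih => rw [Quiver.Path.comp_cons, actGallery, actGallery, ih]

/-- A geodesic arises from the trivial gallery by its own action. -/
theorem actGallery_nil (hpw : 𝒲.IsPreWeylGraph) (hSH : 𝒲.PropertySH) {C D : 𝒲.Chamber}
    {γ : 𝒲.Gallery C D} (hγ : IsGeodesic γ) :
    actGallery hpw γ (.mk .nil (isGeodesic_nil C)) = .mk γ hγ := by
  induction γ with
  | nil => rfl
  | cons β i ih =>
    have hr : M.toCoxeterSystem.IsReduced (word β ++ [i.type]) := hγ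
    rw [actGallery, ih (M.toCoxeterSystem.isReduced_of_append_left hr), actArrow_mk hpw hSH _ hr]
    congr 1
    exact Gallery.snoc_of_not_isTrivialArrow β i.nontrivial

/-! ### The action within a residue -/

section RankTwo

variable {B C D E : 𝒲.Chamber} {A : Set S}

theorem isGeodesic_comp {γ : 𝒲.Gallery C B} {α : 𝒲.Gallery B D}
    (hγ : ∀ ω, M.toCoxeterSystem.IsReduced ω → (∀ x ∈ ω, x ∈ A) →
      M.toCoxeterSystem.IsReduced (word γ ++ ω))
    (hα : IsGeodesic α) (hA : ∀ x ∈ word α, x ∈ A) : IsGeodesic (γ.comp α) := by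
  rw [IsGeodesic, word, Gallery.word_comp]
  exact hγ _ hα hA

theorem mem_word_snoc {s : S} (hs : s ∈ A) {α : 𝒲.Gallery C D} (hA : ∀ x ∈ word α, x ∈ A)
    (a : 𝒲.Arrow s D E) : ∀ x ∈ word (Gallery.snoc α a), x ∈ A := by
  intro x hx
  rcases Gallery.word_snoc α a with h | h <;> rw [word, h] at hx
  · exact hA x hx
  · rcases List.mem_append.1 hx with hx | hx
    · exact hA x hx
    · rw [List.mem_singleton.1 hx]; exact hs

/-- An arrow of type in `A` acts within a residue of type `A`. -/
theorem exists_actArrow_mk_comp (hpw : 𝒲.IsPreWeylGraph) (hSH : 𝒲.PropertySH)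
    {γ : 𝒲.Gallery C B} {α : 𝒲.Gallery B D}
    (hγ : ∀ ω, M.toCoxeterSystem.IsReduced ω → (∀ x ∈ ω, x ∈ A) →
      M.toCoxeterSystem.IsReduced (word γ ++ ω))
    (hα : IsGeodesic α) (hA : ∀ x ∈ word α, x ∈ A) {s : S} (hs : s ∈ A) (a : 𝒲.Arrow s D E) :
    ∃ (α' : 𝒲.Gallery B E) (hα' : IsGeodesic α') (hA' : ∀ x ∈ word α', x ∈ A),
      Homotopic α' (Gallery.snoc α a) ∧
        actArrow hpw a (.mk (γ.comp α) (isGeodesic_comp hγ hα hA)) =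
          .mk (γ.comp α') (isGeodesic_comp hγ hα' hA') := by
  obtain ⟨F, β, b, hβ, hsub, hb⟩ := hα.exists_strictlyHomotopic_snoc hpw s
  have hβA : ∀ x ∈ word β ++ [s], x ∈ A := by
    intro x hx
    rcases List.mem_append.1 hx with hx | hx
    · rcases List.mem_append.1 (hsub hx) with hx | hx
      · exact hA x hx
      · rw [List.mem_singleton.1 hx]; exact hs
    · rw [List.mem_singleton.1 hx]; exact hs
  have hr : M.toCoxeterSystem.IsReduced (word (γ.comp β) ++ [s]) := by
    rw [word, Gallery.word_comp, List.append_assoc]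
    exact hγ _ hβ hβA
  refine ⟨Gallery.snoc β (compArrow b a), isGeodesic_snoc hβ _,
    mem_word_snoc hs (fun x hx => hβA x (List.mem_append_left _ hx)) _, ?_, ?_⟩
  · exact (homotopic_snoc_snoc β b a).symm.trans (hb.homotopic.symm.snoc a)
  · have h₁ : GeodesicClass.mk (γ.comp α) (isGeodesic_comp hγ hα hA) =
        .mk (Gallery.snoc (γ.comp β) b) (isGeodesic_snoc hr b) := by
      rw [GeodesicClass.mk_eq_mk_iff, ← Gallery.comp_snoc]
      exact hb.comp_left γ
    rw [h₁, actArrow_mk_snoc hpw hSH a hr]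
    simp only [Gallery.comp_snoc]

/-- A gallery with type in `A` acts within a residue of type `A`. -/
theorem exists_actGallery_mk_comp (hpw : 𝒲.IsPreWeylGraph) (hSH : 𝒲.PropertySH)
    {γ : 𝒲.Gallery C B} {α : 𝒲.Gallery B D}
    (hγ : ∀ ω, M.toCoxeterSystem.IsReduced ω → (∀ x ∈ ω, x ∈ A) →
      M.toCoxeterSystem.IsReduced (word γ ++ ω))
    (hα : IsGeodesic α) (hA : ∀ x ∈ word α, x ∈ A) (β : 𝒲.Gallery D E)
    (hβ : ∀ x ∈ word β, x ∈ A) :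
    ∃ (α' : 𝒲.Gallery B E) (hα' : IsGeodesic α') (hA' : ∀ x ∈ word α', x ∈ A),
      Homotopic α' (α.comp β) ∧
        actGallery hpw β (.mk (γ.comp α) (isGeodesic_comp hγ hα hA)) =
          .mk (γ.comp α') (isGeodesic_comp hγ hα' hA') := by
  induction β with
  | nil => exact ⟨α, hα, hA, .refl _, rfl⟩
  | cons β i ih =>
    rw [word, Gallery.word_cons] at hβ
    obtain ⟨α₁, hα₁, hA₁, hh₁, he₁⟩ := ih fun x hx => hβ x (List.mem_append_left _ hx)
    obtain ⟨α₂, hα₂, hA₂, hh₂, he₂⟩ := exists_actArrow_mk_comp hpw hSH hγ hα₁ hA₁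
      (hβ i.type (by simp)) i.arrow
    refine ⟨α₂, hα₂, hA₂, hh₂.trans ((hh₁.snoc i.arrow).trans ?_), ?_⟩
    · rw [Gallery.snoc_of_not_isTrivialArrow _ i.nontrivial]
      exact .refl _
    · rw [actGallery, he₁, he₂]

end RankTwo

/-! ### The 2-Weyl condition and defining suites -/

section Dihedral

variable {C D : 𝒲.Chamber} {s t : S}

theorem isAlternatingGeodesic_of_mem (hst : s ≠ t) (hM : M s t ≠ 0) {γ : 𝒲.Gallery C D}
    (hγ : IsGeodesic γ) (hA : ∀ x ∈ word γ, x ∈ ({s, t} : Set S)) : IsAlternatingGeodesic γ := by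
  refine ⟨hγ, ?_⟩
  rcases CoxeterSystem.IsReduced.eq_alternatingFrom hγ hA with h | h
  · exact ⟨s, t, hst, hM, _, h⟩
  · exact ⟨t, s, hst.symm, M.symmetric s t ▸ hM, _, h⟩

/-- In a `2`-Weyl graph, homotopic geodesics with type in `{s,t}` are strictly homotopic. -/
theorem IsTwoWeylGraph.strictlyHomotopic_of_mem (h2 : 𝒲.IsTwoWeylGraph) (hst : s ≠ t)
    (hM : M s t ≠ 0) {γ γ' : 𝒲.Gallery C D} (hγ : IsGeodesic γ) (hγ' : IsGeodesic γ')
    (hA : ∀ x ∈ word γ, x ∈ ({s, t} : Set S)) (hA' : ∀ x ∈ word γ', x ∈ ({s, t} : Set S))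
    (h : Homotopic γ γ') : StrictlyHomotopic γ γ' := by
  -- Equal `W`-lengths let `γ` be moved to the type of `γ'`; the rank 2 case of (W) ⇒ (H) then
  -- identifies the two galleries.
  obtain ⟨γ'', hw, hh⟩ := hγ.exists_strictlyHomotopic h2.toIsPreWeylGraph hγ'
    (h2.twoW γ γ' (isAlternatingGeodesic_of_mem hst hM hγ hA)
      (isAlternatingGeodesic_of_mem hst hM hγ' hA') h).symm
  have hprefix : ∀ {D : 𝒲.Chamber} (β : 𝒲.Gallery C D), word β <+: word γ' →
      IsAlternatingGeodesic β := by
    intro D β hβ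
    refine isAlternatingGeodesic_of_mem hst hM ?_ fun x hx => hA' x (hβ.subset hx)
    obtain ⟨l, hl⟩ := hβ
    exact M.toCoxeterSystem.isReduced_of_append_left (ω' := l) (by rw [hl]; exact hγ')
  obtain rfl := eq_of_homotopic_of_wLength_eq hγ'
    (fun β β' hβ hβ' hh => h2.twoW β β' (hprefix β hβ) (hprefix β' hβ') hh) hw rfl
    (hh.homotopic.symm.trans h)
  exact hh

/-- Null-homotopic closed galleries with type in `{s,t}` act trivially. -/
theorem IsTwoWeylGraph.actGallery_eq_self (h2 : 𝒲.IsTwoWeylGraph) (hSH : 𝒲.PropertySH)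
    (hst : s ≠ t) (hM : M s t ≠ 0) {β : 𝒲.Gallery D D}
    (hβ : ∀ x ∈ word β, x ∈ ({s, t} : Set S)) (hh : Homotopic β .nil)
    (x : 𝒲.GeodesicClass C D) : actGallery h2.toIsPreWeylGraph β x = x := by
  have hpw := h2.toIsPreWeylGraph
  obtain ⟨⟨γ, hγ⟩, rfl⟩ := Quotient.exists_rep x
  change actGallery _ β (GeodesicClass.mk γ hγ) = .mk γ hγ
  -- Choose the representative adapted to the `{s,t}`-coset of the `W`-length, so that `β` acts on
  -- its dihedral tail alone.
  obtain ⟨u, v, hv, hvA, hw, hu⟩ :=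
    M.toCoxeterSystem.exists_minimal_coset_word {s, t} (wLength γ)
  obtain ⟨γ', hw', hs⟩ := hγ.exists_strictlyHomotopic hpw (hu v hv hvA) hw
  obtain ⟨B, γ₀, α, rfl, rfl, rfl⟩ := Gallery.exists_eq_comp hw'
  have he : GeodesicClass.mk γ hγ = .mk (γ₀.comp α) (isGeodesic_comp hu hv hvA) :=
    GeodesicClass.mk_eq_mk_iff.2 hs
  obtain ⟨α', hα', hA', hh', he'⟩ := exists_actGallery_mk_comp hpw hSH hu hv hvA β hβ
  rw [he, he', GeodesicClass.mk_eq_mk_iff]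
  exact (h2.strictlyHomotopic_of_mem hst hM hα' hv hA' hvA
    (hh'.trans (hh.comp_left α))).comp_left γ₀

end Dihedral

/-- Homotopic galleries act in the same way. -/
theorem IsTwoWeylGraph.actGallery_eq_of_homotopic (h2 : 𝒲.IsTwoWeylGraph) (hSH : 𝒲.PropertySH)
    {C D E : 𝒲.Chamber} {β β' : 𝒲.Gallery D E} (h : Homotopic β β') (x : 𝒲.GeodesicClass C D) :
    actGallery h2.toIsPreWeylGraph β x = actGallery h2.toIsPreWeylGraph β' x := by
  have hpw := h2.toIsPreWeylGraph
  induction h with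
  | refl _ => rfl
  | symm _ _ _ ih => exact ih.symm
  | trans _ _ _ _ _ ih ih' => exact ih.trans ih'
  | rel β β' h =>
    cases h with
    | backtrack β i β' =>
      simp only [actGallery_comp]
      refine congrArg (actGallery _ β') ?_
      change actArrow hpw (invArrow i.arrow) (actArrow hpw i.arrow _) = _
      rw [actArrow_actArrow _ hSH, compArrow_inv, actArrow_id _ hSH]
      rfl
    | shortcut β s j j' β' hj hj' hjj' =>
      simp only [actGallery_comp]
      refine congrArg (actGallery _ β') ?_
      exact actArrow_actArrow _ hSH j j' _
    | suite β s t θ β' hθ =>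
      simp only [actGallery_comp]
      refine congrArg (actGallery _ β') ?_
      have hh : Homotopic θ .nil := by
        have := Contraction.suite .nil s t θ .nil hθ
        rw [Quiver.Path.nil_comp, Quiver.Path.comp_nil] at this
        exact .rel _ _ this
      refine h2.actGallery_eq_self hSH (𝒲.ne_of_mem hθ) (𝒲.finite_of_mem hθ) ?_ hh _
      intro x hx
      rw [word, 𝒲.word_of_mem hθ] at hx
      exact mem_alternatingFrom hx

/-! ### The Weyl properties -/

theorem PropertyC.propertyW (h : 𝒲.PropertyC) : 𝒲.PropertyW :=
  fun γ γ' hγ hγ' hh => (h γ γ' hγ hγ' hh).wLength_eq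

theorem PropertyW.propertyH (h : 𝒲.PropertyW) : 𝒲.PropertyH := by
  intro C D γ γ' hγ _ hw hh
  have hprefix : ∀ {E : 𝒲.Chamber} (β : 𝒲.Gallery C E), word β <+: word γ → IsGeodesic β := by
    rintro E β ⟨l, hl⟩
    exact M.toCoxeterSystem.isReduced_of_append_left (ω' := l) (by rw [hl]; exact hγ)
  exact eq_of_homotopic_of_wLength_eq hγ
    (fun β β' hβ hβ' => h β β' (hprefix β hβ) (hprefix β' hβ')) rfl hw.symm hh

theorem PropertyH.propertySH (h : 𝒲.PropertyH) : 𝒲.PropertySH :=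
  fun γ γ' hγ hγ' hw hh => h γ γ' hγ hγ' hw hh.homotopic

/-- Both geodesics act on the class of the empty gallery with the same result, and these results are
their own strict homotopy classes. -/
theorem PropertySH.propertyC (h2 : 𝒲.IsTwoWeylGraph) (h : 𝒲.PropertySH) : 𝒲.PropertyC := by
  intro C D γ γ' hγ hγ' hh
  have := h2.actGallery_eq_of_homotopic h hh (.mk .nil (isGeodesic_nil C))
  rwa [actGallery_nil _ h hγ, actGallery_nil _ h hγ', GeodesicClass.mk_eq_mk_iff] at this

theorem IsWeylGraph.isTwoWeylGraph (h : 𝒲.IsWeylGraph) : 𝒲.IsTwoWeylGraph where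
  toIsPreWeylGraph := h.toIsPreWeylGraph
  twoW γ γ' hγ hγ' hh := h.propertyW γ γ' hγ.1 hγ'.1 hh

end WeylData

theorem mainTheorem2 {S : Type u} (M : CoxeterMatrix S) (𝒲 : WeylData.{u, v, w} M) :
    (𝒲.IsTwoWeylGraph →
      ((𝒲.PropertyC → 𝒲.PropertyW) ∧ (𝒲.PropertyW → 𝒲.PropertyH) ∧
        (𝒲.PropertyH → 𝒲.PropertySH) ∧ (𝒲.PropertySH → 𝒲.PropertyC)) ∧
      (𝒲.PropertyC ∨ 𝒲.PropertyW ∨ 𝒲.PropertyH ∨ 𝒲.PropertySH → 𝒲.IsWeylGraph)) ∧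
    (𝒲.IsWeylGraph →
      𝒲.PropertyC ∧ 𝒲.PropertyW ∧ 𝒲.PropertyH ∧ 𝒲.PropertySH) := by
  refine ⟨fun h2 => ?_, fun h => ?_⟩
  · have hSC : 𝒲.PropertySH → 𝒲.PropertyC := fun h => h.propertyC h2
    refine ⟨⟨fun h => h.propertyW, fun h => h.propertyH, fun h => h.propertySH, hSC⟩, fun h => ?_⟩
    refine ⟨h2.toIsPreWeylGraph, ?_⟩
    rcases h with h | h | h | h
    · exact h.propertyW
    · exact h
    · exact WeylData.PropertyC.propertyW (hSC h.propertySH)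
    · exact WeylData.PropertyC.propertyW (hSC h)
  · have hW : 𝒲.PropertyW := h.propertyW
    have hH : 𝒲.PropertyH := WeylData.PropertyW.propertyH hW
    exact ⟨WeylData.PropertySH.propertyC h.isTwoWeylGraph hH.propertySH, hW, hH, hH.propertySH⟩
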